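/- For $d\in\mathbb C^\times$ let $\mathcal K_d$ be the Temperley--Lieb category: the $\mathbb C$-linear strict tensor category with objects $0,1,2,\dots$ (tensor product = addition, $X=1$) whose morphisms are linear combinations of planar tangles up to isotopy, a closed loop being replaced by the scalar $d$; equivalently, it is generated by the two arcs $\epsilon:X\otimes X\to I$ and $\delta: I\to X\otimes X$ with the two relations straightening a bent string and $\epsilon\delta=d$. A fiber functor is a $\mathbb C$-linear monoidal functor $F:\mathcal K_d\to \mathrm{Vec}$ to finite-dimensional complex vector spaces; its dimension is $\dim F(X)$, its form is the bilinear form $F(\epsilon):F(X)\otimes F(X)\to\mathbb C$, and two fiber functors are isomorphic if there is a monoidal natural isomorphism between them. The Hopf algebra associated to $F$ is the Hopf algebra $A$ carrying the universal natural transformation $\rho:F\to F\otimes A$ (every natural transformation $\sigma : F\to F\otimes B$, $B$ a vector space, is $(1\otimes\varphi)\rho$ for a unique linear map $\varphi:A\to B$), with coproduct $\Delta$, counit $\varepsilon$, product $m$ and unit determined by $(1\otimes\Delta)\rho=(\rho\otimes1)\rho$, $(1\otimes\varepsilon)\rho=1$, $\rho_{Y\otimes Z}=(1\otimes m)(\rho_Y\otimes\rho_Z)$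 (with the flip of the middle factors and $F(Y)\otimes F(Z)\cong F(Y\otimes Z)$ understood) and $\rho_I(1)=1\otimes 1$. Let $GL_2(\mathbb C)$ act on itself by $E\mapsto {}^tT E T$, put $\Theta(E)=E^{-1}\,{}^tE$, and let $$E_q=\begin{pmatrix}0&1\\-q^{-1}&0\end{pmatrix}\ (q\in\mathbb C^\times),\qquad E_{\rm s}=\begin{pmatrix}1&1\\-1&0\end{pmatrix}.$$ (a) Orbits. $\Theta(E_q)=-\mathrm{diag}(q,q^{-1})$ and $\Theta(E_{\rm s})=\begin{pmatrix}-1&0\\2&-1\end{pmatrix}$. Every element of $GL_2(\mathbb C)$ lies in the orbit of some $E_q$ or in the orbit of $E_{\rm s}$; $E_q$ and $E_{q'}$ lie in the same orbit if and only if $q'\in\{q,q^{-1}\}$; and $E_{\rm s}$ does not lie in the orbit of any $E_q$. (b) Stabilizers. The stabilizer of $E_q$ is $\{\mathrm{diag}(t,t^{-1}):t\in\mathbb C^\times\}\cong\mathbb C^\times$ for $q\neq\pm1$; it is $\left\{\begin{pmatrix}s&0\\0&s^{-1}\end{pmatrix},\begin{pmatrix}0&t\\t^{-1}&0\end{pmatrix}: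 s,t\in\mathbb C^\times\right\}\cong\mathbb C^\times\rtimes\mathbb Z_2$ (action by inversion) for $q=-1$, and $SL_2(\mathbb C)$ for $q=1$. The stabilizer of $E_{\rm s}$ is $\left\{\pm\begin{pmatrix}1&0\\z&1\end{pmatrix}: z\in\mathbb C\right\}\cong\mathbb C\rtimes\mathbb Z_2$ (with trivial action of $\mathbb Z_2$). (c) Let $d\in\mathbb C^\times$, $d\ne-2$. There is exactly one two-dimensional fiber functor on $\mathcal K_d$ up to isomorphism. There is $q\in\mathbb C^\times$ with $q+q^{-1}=-d$, and for each such $q$ the form of every two-dimensional fiber functor has the matrix $E_q$ in a suitable basis, and the associated Hopf algebra is $SL_q(2)$, the algebra generated by $a,b,c,d$ with the relations $ab=q^{-1}ba$, $ac=q^{-1}ca$, $bd=q^{-1}db$, $cd=q^{-1}dc$, $bc=cb$, $ad-q^{-1}bc=da-qbc=1$ and the coproduct $\Delta(a_{ij})=\sum_k a_{ik}\otimes a_{kj}$, where $\begin{pmatrix}a_{11}&a_{12}\\a_{21}&a_{22}\end{pmatrix}=\begin{pmatrix}a&b\\c&d\end{pmatrix}$. (d) Let $d=-2$. There are exactly two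 two-dimensional fiber functors on $\mathcal K_{-2}$ up to isomorphism. One has the form $E_1$ (in a suitable basis) and the associated Hopf algebra $SL_1(2)$. The other has the form $E_{\rm s}$, and for every $\tau\in\mathbb C^\times$ its associated Hopf algebra is (isomorphic to) Woronowicz's exceptional quantum group, the algebra generated by $a,b,c,d$ with the relations $$\tau a^2-ba+ab=\tau,\quad \tau d^2-bd+db=\tau,\quad \tau ac-bc+ad=1,\quad \tau dc-bc+da=1,$$ $$\tau ca-da+cb=-1,\quad \tau cd-ad+cb=-1,\quad \tau c^2-dc+cd=0,\quad \tau c^2-ac+ca=0$$ and the coproduct given by the same formula. -/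

import Mathlib

open CategoryTheory MonoidalCategory
open scoped TensorProduct Matrix

/-! ### The Temperley-Lieb category -/

/-- Formal expressions for linear combinations of planar tangles with `m` end points at the source
and `n` end points at the target.  They are written with the two basic arcs `cap : 2 → 0` and
`cup : 0 → 2`, composition (stacking), tensor product (juxtaposition) and linear combination.
`ident h` is the diagram of `m = n` parallel vertical strings. -/
inductive TLExpr : ℕ → ℕ → Type
  | ident {m n : ℕ} (h : m = n) : TLExpr m n
  | comp {l m n : ℕ} (f : TLExpr l m) (g : TLExpr m n) : TLExpr l n
  | tensor {m n m' n' : ℕ} (f : TLExpr m n) (g : TLExpr m' n') : TLExpr (m + m') (n + n')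
  | cap : TLExpr (1 + 1) 0
  | cup : TLExpr 0 (1 + 1)
  | zero {m n : ℕ} : TLExpr m n
  | add {m n : ℕ} (f g : TLExpr m n) : TLExpr m n
  | smul {m n : ℕ} (c : ℂ) (f : TLExpr m n) : TLExpr m n

/-- Two expressions are related if they agree in the strict `ℂ`-linear tensor category of planar
tangles: the axioms of a `ℂ`-linear strict tensor category, the isotopies that straighten a bent
string, and the removal of a closed loop at the price of the factor `d`. -/
inductive TLRel (d : ℂ) : ∀ {m n : ℕ}, TLExpr m n → TLExpr m n → Prop
  | refl {m n : ℕ} (f : TLExpr m n) : TLRel d f f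
  | symm {m n : ℕ} {f g : TLExpr m n} : TLRel d f g → TLRel d g f
  | trans {m n : ℕ} {f g h : TLExpr m n} : TLRel d f g → TLRel d g h → TLRel d f h
  -- compatibility with the operations
  | congr_comp {l m n : ℕ} {f f' : TLExpr l m} {g g' : TLExpr m n} :
      TLRel d f f' → TLRel d g g' → TLRel d (f.comp g) (f'.comp g')
  | congr_tensor {m n m' n' : ℕ} {f f' : TLExpr m n} {g g' : TLExpr m' n'} :
      TLRel d f f' → TLRel d g g' → TLRel d (f.tensor g) (f'.tensor g')
  | congr_add {m n : ℕ} {f f' g g' : TLExpr m n} :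
      TLRel d f f' → TLRel d g g' → TLRel d (f.add g) (f'.add g')
  | congr_smul {m n : ℕ} (c : ℂ) {f f' : TLExpr m n} :
      TLRel d f f' → TLRel d (f.smul c) (f'.smul c)
  -- category axioms
  | id_comp {m n : ℕ} (f : TLExpr m n) : TLRel d ((TLExpr.ident rfl).comp f) f
  | comp_id {m n : ℕ} (f : TLExpr m n) : TLRel d (f.comp (TLExpr.ident rfl)) f
  | assoc {k l m n : ℕ} (f : TLExpr k l) (g : TLExpr l m) (h : TLExpr m n) :
      TLRel d ((f.comp g).comp h) (f.comp (g.comp h))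
  -- vector space axioms
  | add_assoc {m n : ℕ} (f g h : TLExpr m n) : TLRel d ((f.add g).add h) (f.add (g.add h))
  | add_comm {m n : ℕ} (f g : TLExpr m n) : TLRel d (f.add g) (g.add f)
  | zero_add {m n : ℕ} (f : TLExpr m n) : TLRel d (TLExpr.zero.add f) f
  | neg_add {m n : ℕ} (f : TLExpr m n) : TLRel d ((f.smul (-1)).add f) TLExpr.zero
  | smul_add {m n : ℕ} (c : ℂ) (f g : TLExpr m n) :
      TLRel d ((f.add g).smul c) ((f.smul c).add (g.smul c))
  | add_smul {m n : ℕ} (c c' : ℂ) (f : TLExpr m n) :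
      TLRel d (f.smul (c + c')) ((f.smul c).add (f.smul c'))
  | mul_smul {m n : ℕ} (c c' : ℂ) (f : TLExpr m n) :
      TLRel d (f.smul (c * c')) ((f.smul c').smul c)
  | one_smul {m n : ℕ} (f : TLExpr m n) : TLRel d (f.smul 1) f
  -- composition and tensor product are bilinear
  | add_comp {l m n : ℕ} (f f' : TLExpr l m) (g : TLExpr m n) :
      TLRel d ((f.add f').comp g) ((f.comp g).add (f'.comp g))
  | comp_add {l m n : ℕ} (f : TLExpr l m) (g g' : TLExpr m n) :
      TLRel d (f.comp (g.add g')) ((f.comp g).add (f.comp g'))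
  | smul_comp {l m n : ℕ} (c : ℂ) (f : TLExpr l m) (g : TLExpr m n) :
      TLRel d ((f.smul c).comp g) ((f.comp g).smul c)
  | comp_smul {l m n : ℕ} (c : ℂ) (f : TLExpr l m) (g : TLExpr m n) :
      TLRel d (f.comp (g.smul c)) ((f.comp g).smul c)
  | add_tensor {m n m' n' : ℕ} (f f' : TLExpr m n) (g : TLExpr m' n') :
      TLRel d ((f.add f').tensor g) ((f.tensor g).add (f'.tensor g))
  | tensor_add {m n m' n' : ℕ} (f : TLExpr m n) (g g' : TLExpr m' n') :
      TLRel d (f.tensor (g.add g')) ((f.tensor g).add (f.tensor g'))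
  | smul_tensor {m n m' n' : ℕ} (c : ℂ) (f : TLExpr m n) (g : TLExpr m' n') :
      TLRel d ((f.smul c).tensor g) ((f.tensor g).smul c)
  | tensor_smul {m n m' n' : ℕ} (c : ℂ) (f : TLExpr m n) (g : TLExpr m' n') :
      TLRel d (f.tensor (g.smul c)) ((f.tensor g).smul c)
  -- the tensor product is a strictly associative and strictly unital bifunctor
  | tensor_id (m n : ℕ) : TLRel d
      ((TLExpr.ident (rfl : m = m)).tensor (TLExpr.ident (rfl : n = n))) (TLExpr.ident rfl)
  | interchange {l m n l' m' n' : ℕ} (f : TLExpr l m) (g : TLExpr m n)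
      (f' : TLExpr l' m') (g' : TLExpr m' n') :
      TLRel d ((f.tensor f').comp (g.tensor g')) ((f.comp g).tensor (f'.comp g'))
  | tensor_assoc {m n m' n' m'' n'' : ℕ}
      (f : TLExpr m n) (g : TLExpr m' n') (h : TLExpr m'' n'') :
      TLRel d (((f.tensor g).tensor h).comp (TLExpr.ident (Nat.add_assoc n n' n'')))
        ((TLExpr.ident (Nat.add_assoc m m' m'')).comp (f.tensor (g.tensor h)))
  | unit_tensor {m n : ℕ} (f : TLExpr m n) :
      TLRel d (((TLExpr.ident (rfl : 0 = 0)).tensor f).comp (TLExpr.ident (Nat.zero_add n)))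
        ((TLExpr.ident (Nat.zero_add m)).comp f)
  | tensor_unit {m n : ℕ} (f : TLExpr m n) :
      TLRel d ((f.tensor (TLExpr.ident (rfl : 0 = 0))).comp (TLExpr.ident (Nat.add_zero n)))
        ((TLExpr.ident (Nat.add_zero m)).comp f)
  -- planar isotopy: both ways of straightening a bent string
  | zigzag_left : TLRel d
      (((TLExpr.ident (rfl : 1 = 1)).tensor TLExpr.cup).comp
        ((TLExpr.ident (Nat.add_assoc 1 1 1).symm).comp
          (TLExpr.cap.tensor (TLExpr.ident (rfl : 1 = 1)))))
      (TLExpr.ident (by norm_num))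
  | zigzag_right : TLRel d
      ((TLExpr.cup.tensor (TLExpr.ident (rfl : 1 = 1))).comp
        ((TLExpr.ident (Nat.add_assoc 1 1 1)).comp
          ((TLExpr.ident (rfl : 1 = 1)).tensor TLExpr.cap)))
      (TLExpr.ident (by norm_num))
  -- a closed loop has the value `d`
  | loop : TLRel d (TLExpr.cup.comp TLExpr.cap) ((TLExpr.ident rfl).smul d)

/-- Equality of morphisms of the Temperley-Lieb category. -/
def tlSetoid (d : ℂ) (m n : ℕ) : Setoid (TLExpr m n) where
  r := TLRel d
  iseqv := ⟨TLRel.refl, TLRel.symm, TLRel.trans⟩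

/-- The Temperley-Lieb category `K_d`; its objects are the natural numbers. -/
structure TL (d : ℂ) where
  /-- the number of strings -/
  n : ℕ

namespace TL

variable {d : ℂ}

/-- Morphisms of `K_d`: linear combinations of planar tangles up to isotopy and loop removal. -/
def HomTL (d : ℂ) (m n : ℕ) : Type := Quotient (tlSetoid d m n)

/-- The class of an expression. -/
def cls {m n : ℕ} (f : TLExpr m n) : HomTL d m n := Quotient.mk (tlSetoid d m n) f

theorem cls_sound {m n : ℕ} {f g : TLExpr m n} (h : TLRel d f g) :
    (cls f : HomTL d m n) = cls g := Quotient.sound h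

/-- Composition of morphisms. -/
def compHom {l m n : ℕ} : HomTL d l m → HomTL d m n → HomTL d l n :=
  Quotient.map₂ TLExpr.comp fun _ _ h _ _ h' => TLRel.congr_comp h h'

/-- Tensor product of morphisms. -/
def tensorHomTL {m n m' n' : ℕ} :
    HomTL d m n → HomTL d m' n' → HomTL d (m + m') (n + n') :=
  Quotient.map₂ TLExpr.tensor fun _ _ h _ _ h' => TLRel.congr_tensor h h'

instance (m n : ℕ) : Add (HomTL d m n) where
  add := Quotient.map₂ TLExpr.add fun _ _ h _ _ h' => TLRel.congr_add h h'

instance (m n : ℕ) : Zero (HomTL d m n) where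
  zero := cls TLExpr.zero

instance (m n : ℕ) : Neg (HomTL d m n) where
  neg := Quotient.map (TLExpr.smul (-1)) fun _ _ h => TLRel.congr_smul _ h

/-- The vector space structure on the set of morphisms. -/
instance (m n : ℕ) : AddCommGroup (HomTL d m n) where
  add_assoc := by
    rintro ⟨f⟩ ⟨g⟩ ⟨h⟩; exact cls_sound (.add_assoc f g h)
  zero_add := by
    rintro ⟨f⟩; exact cls_sound (.zero_add f)
  add_zero := by
    rintro ⟨f⟩; exact cls_sound ((TLRel.add_comm _ _).trans (.zero_add f))
  neg_add_cancel := by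
    rintro ⟨f⟩; exact cls_sound (.neg_add f)
  add_comm := by
    rintro ⟨f⟩ ⟨g⟩; exact cls_sound (.add_comm f g)
  nsmul := nsmulRec
  zsmul := zsmulRec

instance (m n : ℕ) : SMul ℂ (HomTL d m n) where
  smul c := Quotient.map (TLExpr.smul c) fun _ _ h => TLRel.congr_smul _ h

instance (m n : ℕ) : Module ℂ (HomTL d m n) :=
  Module.ofMinimalAxioms
    (by rintro c ⟨f⟩ ⟨g⟩; exact cls_sound (.smul_add c f g))
    (by rintro c c' ⟨f⟩; exact cls_sound (.add_smul c c' f))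
    (by rintro c c' ⟨f⟩; exact cls_sound (.mul_smul c c' f))
    (by rintro ⟨f⟩; exact cls_sound (.one_smul f))

instance : Category (TL d) where
  Hom A B := HomTL d A.n B.n
  id A := cls (TLExpr.ident rfl)
  comp f g := compHom f g
  id_comp := by rintro A B ⟨f⟩; exact cls_sound (.id_comp f)
  comp_id := by rintro A B ⟨f⟩; exact cls_sound (.comp_id f)
  assoc := by rintro A B C D ⟨f⟩ ⟨g⟩ ⟨h⟩; exact cls_sound (.assoc f g h)

instance : Preadditive (TL d) where
  homGroup A B := inferInstanceAs (AddCommGroup (HomTL d A.n B.n))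
  add_comp := by rintro A B C ⟨f⟩ ⟨f'⟩ ⟨g⟩; exact cls_sound (.add_comp f f' g)
  comp_add := by rintro A B C ⟨f⟩ ⟨g⟩ ⟨g'⟩; exact cls_sound (.comp_add f g g')

instance : Linear ℂ (TL d) where
  homModule A B := inferInstanceAs (Module ℂ (HomTL d A.n B.n))
  smul_comp := by rintro A B C c ⟨f⟩ ⟨g⟩; exact cls_sound (.smul_comp c f g)
  comp_smul := by rintro A B C ⟨f⟩ c ⟨g⟩; exact cls_sound (.comp_smul c f g)

/-- The morphism given by parallel vertical strings. -/
def identHom {A B : TL d} (h : A.n = B.n) : A ⟶ B := cls (TLExpr.ident h)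

theorem compHom_identHom {l m n : ℕ} (h : l = m) (h' : m = n) :
    compHom (cls (TLExpr.ident h) : HomTL d l m) (cls (TLExpr.ident h')) =
      cls (TLExpr.ident (h.trans h')) := by
  subst h h'; exact cls_sound (.id_comp _)

theorem tensorHom_identHom {m n m' n' : ℕ} (h : m = n) (h' : m' = n') :
    tensorHomTL (cls (TLExpr.ident h) : HomTL d m n) (cls (TLExpr.ident h')) =
      cls (TLExpr.ident (by rw [h, h'])) := by
  subst h h'; exact cls_sound (.tensor_id _ _)

/-- Parallel vertical strings are an isomorphism. -/
def identIso {A B : TL d} (h : A.n = B.n) : A ≅ B where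
  hom := identHom h
  inv := identHom h.symm
  hom_inv_id := compHom_identHom _ _
  inv_hom_id := compHom_identHom _ _

instance : MonoidalCategoryStruct (TL d) where
  tensorObj A B := ⟨A.n + B.n⟩
  whiskerLeft A _ _ f := tensorHomTL (cls (TLExpr.ident (rfl : A.n = A.n))) f
  whiskerRight f A := tensorHomTL f (cls (TLExpr.ident (rfl : A.n = A.n)))
  tensorHom f g := tensorHomTL f g
  tensorUnit := ⟨0⟩
  associator A B C := identIso (Nat.add_assoc A.n B.n C.n)
  leftUnitor A := identIso (Nat.zero_add A.n)
  rightUnitor A := identIso (Nat.add_zero A.n)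

/-- The tensor product adds numbers of strings; it is strict in the sense that associators and
unitors are given by parallel vertical strings. -/
instance : MonoidalCategory (TL d) :=
  MonoidalCategory.ofTensorHom
    (id_tensorHom_id := fun _ _ => cls_sound (.tensor_id _ _))
    (id_tensorHom := fun _ _ _ _ => rfl)
    (tensorHom_id := fun _ _ => rfl)
    (tensorHom_comp_tensorHom := by
      rintro _ _ _ _ _ _ ⟨f⟩ ⟨g⟩ ⟨f'⟩ ⟨g'⟩; exact cls_sound (.interchange f f' g g'))
    (associator_naturality := by
      rintro _ _ _ _ _ _ ⟨f⟩ ⟨g⟩ ⟨h⟩; exact cls_sound (.tensor_assoc f g h))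
    (leftUnitor_naturality := by
      rintro _ _ ⟨f⟩; exact cls_sound (.unit_tensor f))
    (rightUnitor_naturality := by
      rintro _ _ ⟨f⟩; exact cls_sound (.tensor_unit f))
    (pentagon := fun W X Y Z => by
      change compHom (tensorHomTL (cls _) (cls _)) (compHom (cls _) (tensorHomTL (cls _) (cls _))) =
        compHom (cls _) (cls _)
      rw [tensorHom_identHom, tensorHom_identHom, compHom_identHom, compHom_identHom,
        compHom_identHom])
    (triangle := fun X Y => by
      change compHom (cls _) (tensorHomTL (cls _) (cls _)) = tensorHomTL (cls _) (cls _)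
      rw [tensorHom_identHom, tensorHom_identHom, compHom_identHom])

instance : MonoidalPreadditive (TL d) where
  whiskerLeft_zero {Y Z W} := by
    have h : (Y ◁ (0 : Z ⟶ W)) + Y ◁ (0 : Z ⟶ W) = Y ◁ ((0 : Z ⟶ W) + 0) :=
      (cls_sound (.tensor_add _ _ _)).symm
    simpa using h
  zero_whiskerRight {Y Z W} := by
    have h : ((0 : Z ⟶ W) ▷ Y) + (0 : Z ⟶ W) ▷ Y = ((0 : Z ⟶ W) + 0) ▷ Y :=
      (cls_sound (.add_tensor _ _ _)).symm
    simpa using h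
  whiskerLeft_add := by rintro _ _ _ ⟨f⟩ ⟨g⟩; exact cls_sound (.tensor_add _ f g)
  add_whiskerRight := by rintro _ _ _ ⟨f⟩ ⟨g⟩; exact cls_sound (.add_tensor f g _)

instance : MonoidalLinear ℂ (TL d) where
  whiskerLeft_smul := by rintro _ _ _ c ⟨f⟩; exact cls_sound (.tensor_smul c _ f)
  smul_whiskerRight := by rintro c _ _ ⟨f⟩ _; exact cls_sound (.smul_tensor c f _)

/-- The generating object `X`, a single string. -/
def X : TL d := ⟨1⟩

/-- The basic arc `ε : X ⊗ X → I`. -/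
def arc : (X ⊗ X : TL d) ⟶ 𝟙_ (TL d) := cls TLExpr.cap

end TL

/-! ### Fiber functors -/

/-- A fiber functor on `K_d`: a `ℂ`-linear monoidal functor to finite-dimensional vector spaces. -/
structure FiberFunctor (d : ℂ) where
  /-- the underlying functor -/
  functor : TL d ⥤ FGModuleCat.{0} ℂ
  /-- the functor is additive on morphisms -/
  additive : functor.Additive
  /-- the functor is `ℂ`-linear on morphisms -/
  linear : functor.Linear ℂ
  /-- the multiplicativity isomorphisms and the unit isomorphism -/
  monoidal : functor.Monoidal

namespace FiberFunctor

attribute [instance] FiberFunctor.additive FiberFunctor.linear FiberFunctor.monoidal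

variable {d : ℂ}

/-- Monoidal equivalence of fiber functors: a natural isomorphism compatible with the
multiplicativity isomorphisms (and with the unit). -/
def Equivalent (F G : FiberFunctor d) : Prop :=
  ∃ t : F.functor ≅ G.functor, NatTrans.IsMonoidal t.hom

/-- The vector space `F(A)`. -/
abbrev space (F : FiberFunctor d) (A : TL d) : Type := (F.functor.obj A).carrier

/-- The linear map `F(f)`. -/
def map (F : FiberFunctor d) {A B : TL d} (f : A ⟶ B) : F.space A →ₗ[ℂ] F.space B :=
  (F.functor.map f).hom.hom

/-- The multiplicativity isomorphism `F(A) ⊗ F(B) → F(A ⊗ B)`. -/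
noncomputable def mu (F : FiberFunctor d) (A B : TL d) :
    F.space A ⊗[ℂ] F.space B →ₗ[ℂ] F.space (A ⊗ B) :=
  (Functor.LaxMonoidal.μ F.functor A B).hom.hom

/-- The unit isomorphism `ℂ → F(I)`. -/
noncomputable def unit (F : FiberFunctor d) : ℂ →ₗ[ℂ] F.space (𝟙_ (TL d)) :=
  (Functor.LaxMonoidal.ε F.functor).hom.hom

/-- The inverse `F(I) → ℂ` of the unit isomorphism. -/
noncomputable def unitInv (F : FiberFunctor d) : F.space (𝟙_ (TL d)) →ₗ[ℂ] ℂ :=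
  (Functor.Monoidal.εIso F.functor).inv.hom.hom

/-- The dimension of the fiber functor, `dim F(X)`. -/
noncomputable def dim (F : FiberFunctor d) : ℕ := Module.finrank ℂ (F.space TL.X)

/-- The bilinear form `F(ε) : F(X) ⊗ F(X) → ℂ`. -/
noncomputable def form (F : FiberFunctor d) : F.space TL.X ⊗[ℂ] F.space TL.X →ₗ[ℂ] ℂ :=
  F.unitInv ∘ₗ F.map TL.arc ∘ₗ F.mu TL.X TL.X

/-- In a suitable basis of the two-dimensional space `F(X)`, the bilinear form of `F` has the
matrix `E`. -/
def HasForm (F : FiberFunctor d) (E : Matrix (Fin 2) (Fin 2) ℂ) : Prop :=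
  ∃ b : Module.Basis (Fin 2) ℂ (F.space TL.X), ∀ i j, F.form (b i ⊗ₜ[ℂ] b j) = E i j

/-! ### The Hopf algebra associated to a fiber functor -/

/-- A natural transformation `F → F ⊗ B` for a vector space `B`. -/
structure NatTensor (F : FiberFunctor d) (B : Type) [AddCommGroup B] [Module ℂ B] where
  /-- the components -/
  app (A : TL d) : F.space A →ₗ[ℂ] F.space A ⊗[ℂ] B
  naturality {A A' : TL d} (f : A ⟶ A') :
    app A' ∘ₗ F.map f = (F.map f).rTensor B ∘ₗ app A

/-- The pair `(A, ρ)` is a solution of the universality problem for natural transformations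
`F → F ⊗ B`. -/
def NatTensor.IsUniversal {F : FiberFunctor d} {A : Type} [AddCommGroup A] [Module ℂ A]
    (ρ : F.NatTensor A) : Prop :=
  ∀ (B : Type) [AddCommGroup B] [Module ℂ B] (σ : F.NatTensor B),
    ∃! φ : A →ₗ[ℂ] B, ∀ Y : TL d, σ.app Y = φ.lTensor (F.space Y) ∘ₗ ρ.app Y

/-- `A` is (a realization of) the Hopf algebra associated to the fiber functor `F` by
Tannaka-Krein duality: it carries a universal natural transformation `ρ : F → F ⊗ A` such that
coproduct, counit, product and unit of `A` are the ones determined by `ρ`. -/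
def IsAssociatedHopfAlgebra (F : FiberFunctor d) (A : Type) [Ring A] [HopfAlgebra ℂ A] : Prop :=
  ∃ ρ : F.NatTensor A, ρ.IsUniversal ∧
    -- coproduct: `(1 ⊗ Δ) ρ = (ρ ⊗ 1) ρ`
    (∀ (Y : TL d) (v : F.space Y),
      (Coalgebra.comul (R := ℂ) (A := A)).lTensor (F.space Y) (ρ.app Y v) =
        TensorProduct.assoc ℂ (F.space Y) A A ((ρ.app Y).rTensor A (ρ.app Y v))) ∧
    -- counit: `(1 ⊗ ε) ρ = 1`
    (∀ (Y : TL d) (v : F.space Y),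
      (Coalgebra.counit (R := ℂ) (A := A)).lTensor (F.space Y) (ρ.app Y v) = v ⊗ₜ[ℂ] (1 : ℂ)) ∧
    -- product: `ρ` on `F(Y) ⊗ F(Z)` is `(1 ⊗ m) (flip) (ρ ⊗ ρ)`
    (∀ (Y Z : TL d) (v : F.space Y) (w : F.space Z),
      ρ.app (Y ⊗ Z) (F.mu Y Z (v ⊗ₜ[ℂ] w)) =
        TensorProduct.map (F.mu Y Z) (LinearMap.mul' ℂ A)
          (TensorProduct.tensorTensorTensorComm ℂ (F.space Y) A (F.space Z) A
            (ρ.app Y v ⊗ₜ[ℂ] ρ.app Z w))) ∧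
    -- unit: `ρ_I(1) = 1 ⊗ 1`
    ρ.app (𝟙_ (TL d)) (F.unit 1) = F.unit 1 ⊗ₜ[ℂ] (1 : A)

end FiberFunctor

/-! ### The Hopf algebras -/

/-- The quadratic relations `∑ E_kl x_ki x_lj = E_ij`, `∑ D_ij x_ki x_lj = D_kl` for a `2 × 2` matrix
`x` over an algebra.  They are used to construct the Hopf algebra structures below. -/
def QuadRel (E D : Matrix (Fin 2) (Fin 2) ℂ) {R : Type} [Ring R] [Algebra ℂ R]
    (x : Fin 2 × Fin 2 → R) : Prop :=
  (∀ i j, ∑ k, ∑ l, E k l • (x (k, i) * x (l, j)) = E i j • 1) ∧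
    ∀ k l, ∑ i, ∑ j, D i j • (x (k, i) * x (l, j)) = D k l • 1

theorem QuadRel.map {E D : Matrix (Fin 2) (Fin 2) ℂ} {R S : Type} [Ring R] [Algebra ℂ R]
    [Ring S] [Algebra ℂ S] {x : Fin 2 × Fin 2 → R} (hx : QuadRel E D x) (f : R →ₐ[ℂ] S) :
    QuadRel E D (fun p => f (x p)) := by
  constructor
  · intro i j
    simpa only [map_sum, map_smul, map_mul, map_one] using congrArg f (hx.1 i j)
  · intro i j
    simpa only [map_sum, map_smul, map_mul, map_one] using congrArg f (hx.2 i j)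

theorem QuadRel.prod {E D : Matrix (Fin 2) (Fin 2) ℂ} {R : Type} [Ring R] [Algebra ℂ R]
    {x y : Fin 2 × Fin 2 → R} (hx : QuadRel E D x) (hy : QuadRel E D y)
    (hc : ∀ p s, Commute (x p) (y s)) :
    QuadRel E D (fun p => ∑ m, x (p.1, m) * y (m, p.2)) := by
  have key : ∀ p p' s s', x p * y s * (x p' * y s') = (x p * x p') * (y s * y s') := by
    intro p p' s s'
    rw [mul_assoc, ← mul_assoc (y s), ← (hc p' s).eq, mul_assoc, mul_assoc]
  constructor
  · intro i j
    have h : ∑ m, ∑ n, (∑ k, ∑ l, E k l • (x (k, m) * x (l, n))) * (y (m, i) * y (n, j)) =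
        E i j • 1 := by
      simp only [hx.1, smul_mul_assoc, one_mul, hy.1]
    rw [← h]
    simp only [Fin.sum_univ_two, mul_add, add_mul, key, smul_add, smul_mul_assoc]
    abel
  · intro i j
    have h : ∑ m, ∑ n, (x (i, m) * x (j, n)) * (∑ k, ∑ l, D k l • (y (m, k) * y (n, l))) =
        D i j • 1 := by
      simp only [hy.2, mul_smul_comm, mul_one, hx.2]
    rw [← h]
    simp only [Fin.sum_univ_two, mul_add, add_mul, key, smul_add, mul_smul_comm]
    abel

theorem QuadRel.one (E D : Matrix (Fin 2) (Fin 2) ℂ) :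
    QuadRel E D (fun p => if p.1 = p.2 then (1 : ℂ) else 0) := by
  constructor <;> intro i j <;> fin_cases i <;> fin_cases j <;> simp

section Construction

variable (r : FreeAlgebra ℂ (Fin 2 × Fin 2) → FreeAlgebra ℂ (Fin 2 × Fin 2) → Prop)
  (E D : Matrix (Fin 2) (Fin 2) ℂ)

/-- The relations `r` amount to the quadratic relations given by `E` and `D`. -/
def Presents : Prop :=
  ∀ (R : Type) [Ring R] [Algebra ℂ R] (x : Fin 2 × Fin 2 → R),
    (∀ u v, r u v → FreeAlgebra.lift ℂ x u = FreeAlgebra.lift ℂ x v) ↔ QuadRel E D x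

/-- The generators of the algebra presented by `r`. -/
noncomputable def quotGen (p : Fin 2 × Fin 2) : RingQuot r :=
  RingQuot.mkAlgHom ℂ r (FreeAlgebra.ι ℂ p)

variable {r E D}

theorem quotGen_rel (h : Presents r E D) : QuadRel E D (quotGen r) := by
  refine (h _ _).1 fun u v huv => ?_
  have e : FreeAlgebra.lift ℂ (quotGen r) = RingQuot.mkAlgHom ℂ r := by
    ext p; simp [quotGen]
  rw [e]; exact RingQuot.mkAlgHom_rel ℂ huv

/-- The algebra homomorphism given by images of the generators. -/
noncomputable def quotLift (h : Presents r E D) {R : Type} [Ring R] [Algebra ℂ R]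
    (x : Fin 2 × Fin 2 → R) (hx : QuadRel E D x) : RingQuot r →ₐ[ℂ] R :=
  RingQuot.liftAlgHom ℂ ⟨FreeAlgebra.lift ℂ x, fun {u v} huv => (h R x).2 hx u v huv⟩

theorem quotLift_gen (h : Presents r E D) {R : Type} [Ring R] [Algebra ℂ R]
    (x : Fin 2 × Fin 2 → R) (hx : QuadRel E D x) (p : Fin 2 × Fin 2) :
    quotLift h x hx (quotGen r p) = x p := by
  simp [quotLift, quotGen]

theorem quot_hom_ext {R : Type} [Semiring R] [Algebra ℂ R] {f g : RingQuot r →ₐ[ℂ] R}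
    (h : ∀ p, f (quotGen r p) = g (quotGen r p)) : f = g := by
  apply RingQuot.ringQuot_ext'
  ext p
  exact h p

theorem quot_induction {P : RingQuot r → Prop} (hs : ∀ c : ℂ, P (algebraMap ℂ _ c))
    (hg : ∀ p, P (quotGen r p)) (ha : ∀ x y, P x → P y → P (x + y))
    (hm : ∀ x y, P x → P y → P (x * y)) (x : RingQuot r) : P x := by
  obtain ⟨w, rfl⟩ := RingQuot.mkAlgHom_surjective ℂ r x
  induction w using FreeAlgebra.induction with
  | grade0 c => simpa using hs c
  | grade1 p => exact hg p
  | mul u v hu hv => rw [map_mul]; exact hm _ _ hu hv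
  | add u v hu hv => rw [map_add]; exact ha _ _ hu hv

theorem comul_rel (h : Presents r E D) : QuadRel E D
    (fun p => ∑ m, quotGen r (p.1, m) ⊗ₜ[ℂ] quotGen r (m, p.2)) := by
  have h1 := (quotGen_rel h).map (S := RingQuot r ⊗[ℂ] RingQuot r)
    Algebra.TensorProduct.includeLeft
  have h2 := (quotGen_rel h).map (S := RingQuot r ⊗[ℂ] RingQuot r)
    Algebra.TensorProduct.includeRight
  simpa using h1.prod h2 fun p s => by simp [Commute, SemiconjBy]

/-- The coproduct `a_ij ↦ ∑ a_ik ⊗ a_kj`. -/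
noncomputable def quotComul (h : Presents r E D) : RingQuot r →ₐ[ℂ] RingQuot r ⊗[ℂ] RingQuot r :=
  quotLift h _ (comul_rel h)

theorem quotComul_gen (h : Presents r E D) (i j : Fin 2) : quotComul h (quotGen r (i, j)) =
    ∑ m, quotGen r (i, m) ⊗ₜ[ℂ] quotGen r (m, j) := quotLift_gen _ _ _ _

/-- The counit `a_ij ↦ δ_ij`. -/
noncomputable def quotCounit (h : Presents r E D) : RingQuot r →ₐ[ℂ] ℂ :=
  quotLift h _ (QuadRel.one E D)

theorem quotCounit_gen (h : Presents r E D) (i j : Fin 2) : quotCounit h (quotGen r (i, j)) =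
    if i = j then 1 else 0 := quotLift_gen _ _ _ _

/-- The bialgebra structure with `a_ij ↦ ∑ a_ik ⊗ a_kj` and `a_ij ↦ δ_ij`. -/
noncomputable abbrev quotBialgebra (h : Presents r E D) : Bialgebra ℂ (RingQuot r) :=
  Bialgebra.ofAlgHom (quotComul h) (quotCounit h)
    (by
      apply quot_hom_ext
      rintro ⟨i, j⟩
      simp [quotComul_gen, TensorProduct.tmul_add, TensorProduct.add_tmul]
      abel)
    (by
      apply quot_hom_ext
      rintro ⟨i, j⟩
      fin_cases i <;> simp [quotComul_gen, quotCounit_gen])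
    (by
      apply quot_hom_ext
      rintro ⟨i, j⟩
      fin_cases j <;> simp [quotComul_gen, quotCounit_gen])

/-- The images `∑ D_ik a_lk E_lj` of the generators under the antipode. -/
noncomputable def antiGen (r : FreeAlgebra ℂ (Fin 2 × Fin 2) → FreeAlgebra ℂ (Fin 2 × Fin 2) → Prop)
    (E D : Matrix (Fin 2) (Fin 2) ℂ) (p : Fin 2 × Fin 2) : RingQuot r :=
  ∑ k, ∑ l, (D p.1 k * E l p.2) • quotGen r (l, k)

theorem antiGen_mul (h : Presents r E D) (hDE : D * E = 1) (i j : Fin 2) :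
    ∑ m, antiGen r E D (i, m) * quotGen r (m, j) = if i = j then 1 else 0 := by
  have e : ∑ m, antiGen r E D (i, m) * quotGen r (m, j) =
      ∑ k, D i k • ∑ l, ∑ m, E l m • (quotGen r (l, k) * quotGen r (m, j)) := by
    simp only [antiGen, Fin.sum_univ_two, add_mul, smul_add, smul_mul_assoc, mul_smul]
    abel
  have h2 := congrFun (congrFun hDE i) j
  rw [Matrix.mul_apply, Matrix.one_apply] at h2
  simp only [e, (quotGen_rel h).1, smul_smul, ← Finset.sum_smul, h2]
  split_ifs <;> simp

theorem mul_antiGen (h : Presents r E D) (hDE : D * E = 1) (i j : Fin 2) :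
    ∑ m, quotGen r (i, m) * antiGen r E D (m, j) = if i = j then 1 else 0 := by
  have e : ∑ m, quotGen r (i, m) * antiGen r E D (m, j) =
      ∑ l, E l j • ∑ m, ∑ k, D m k • (quotGen r (i, m) * quotGen r (l, k)) := by
    simp only [antiGen, Fin.sum_univ_two, mul_add, smul_add, mul_smul_comm, mul_smul,
      smul_comm (E _ _) (D _ _)]
    abel
  have h2 := congrFun (congrFun hDE i) j
  rw [Matrix.mul_apply, Matrix.one_apply] at h2
  simp only [e, (quotGen_rel h).2, smul_smul, ← Finset.sum_smul, mul_comm (E _ _), h2]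
  split_ifs <;> simp

theorem antiGen_rel (h : Presents r E D) (hDE : D * E = 1) :
    QuadRel E D (fun p => MulOpposite.op (antiGen r E D p)) := by
  have h1 := antiGen_mul h hDE
  have h2 := mul_antiGen h hDE
  have hq := quotGen_rel h
  -- in matrix form: `E a = ...` obtained from the quadratic relations by multiplying with inverses
  have hE : ∀ i m, ∑ k, E k m • quotGen r (k, i) = ∑ j, E i j • antiGen r E D (j, m) := by
    intro i m
    have := congrArg (fun w : Fin 2 → RingQuot r => ∑ j, w j * antiGen r E D (j, m))
      (funext (hq.1 i))
    simp only [smul_mul_assoc, one_mul] at this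
    rw [← this]
    have e : ∑ j, (∑ k, ∑ l, E k l • (quotGen r (k, i) * quotGen r (l, j))) *
        antiGen r E D (j, m) = ∑ k, ∑ l, E k l • (quotGen r (k, i) *
          ∑ j, quotGen r (l, j) * antiGen r E D (j, m)) := by
      simp only [Fin.sum_univ_two, add_mul, mul_add, smul_add, smul_mul_assoc, mul_assoc]
      abel
    rw [e]
    simp [h2]
  have hD : ∀ i m, ∑ k, D m k • quotGen r (i, k) = ∑ j, D j i • antiGen r E D (m, j) := by
    intro i m
    have := congrArg (fun w : Fin 2 → RingQuot r => ∑ j, antiGen r E D (m, j) * w j)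
      (funext fun j => hq.2 j i)
    simp only [mul_smul_comm, mul_one] at this
    rw [← this]
    have e : ∑ j, antiGen r E D (m, j) *
        (∑ k, ∑ l, D k l • (quotGen r (j, k) * quotGen r (i, l))) =
        ∑ k, ∑ l, D k l • ((∑ j, antiGen r E D (m, j) * quotGen r (j, k)) *
          quotGen r (i, l)) := by
      simp only [Fin.sum_univ_two, add_mul, mul_add, smul_add, mul_smul_comm, mul_assoc]
      abel
    rw [e]
    simp [h1]
  constructor
  · intro i j
    apply MulOpposite.unop_injective
    have e : ∑ k, ∑ l, E k l • (antiGen r E D (l, j) * antiGen r E D (k, i)) =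
        ∑ k, (∑ l, E k l • antiGen r E D (l, j)) * antiGen r E D (k, i) := by
      simp only [Fin.sum_univ_two, add_mul, smul_mul_assoc]
    have e2 : ∑ k, (∑ l, E k l • antiGen r E D (l, j)) * antiGen r E D (k, i) =
        ∑ l, E l j • ∑ k, quotGen r (l, k) * antiGen r E D (k, i) := by
      simp only [← hE, Fin.sum_univ_two, add_mul, smul_mul_assoc, smul_add]
      abel
    simp only [h2] at e2
    simpa [e2] using e.trans e2
  · intro i j
    apply MulOpposite.unop_injective
    have e : ∑ k, ∑ l, D k l • (antiGen r E D (j, l) * antiGen r E D (i, k)) =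
        ∑ l, antiGen r E D (j, l) * (∑ k, D k l • antiGen r E D (i, k)) := by
      simp only [Fin.sum_univ_two, mul_add, mul_smul_comm]
      abel
    have e2 : ∑ l, antiGen r E D (j, l) * (∑ k, D k l • antiGen r E D (i, k)) =
        ∑ k, D i k • ∑ l, antiGen r E D (j, l) * quotGen r (l, k) := by
      simp only [← hD, Fin.sum_univ_two, mul_add, mul_smul_comm, smul_add]
      abel
    simp only [h1] at e2
    simpa [e2] using e.trans e2

/-- The antipode as an algebra homomorphism to the opposite algebra. -/
noncomputable def quotAnti (h : Presents r E D) (hDE : D * E = 1) :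
    RingQuot r →ₐ[ℂ] (RingQuot r)ᵐᵒᵖ :=
  quotLift h _ (antiGen_rel h hDE)

/-- The antipode. -/
noncomputable def quotAntipode (h : Presents r E D) (hDE : D * E = 1) :
    RingQuot r →ₗ[ℂ] RingQuot r :=
  (MulOpposite.opLinearEquiv ℂ).symm.toLinearMap ∘ₗ (quotAnti h hDE).toLinearMap

theorem quotAntipode_gen (h : Presents r E D) (hDE : D * E = 1) (p : Fin 2 × Fin 2) :
    quotAntipode h hDE (quotGen r p) = antiGen r E D p := by
  simp [quotAntipode, quotAnti, quotLift_gen]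

theorem quotAntipode_mul (h : Presents r E D) (hDE : D * E = 1) (x y : RingQuot r) :
    quotAntipode h hDE (x * y) = quotAntipode h hDE y * quotAntipode h hDE x := by
  simp [quotAntipode]

theorem quotAntipode_algebraMap (h : Presents r E D) (hDE : D * E = 1) (c : ℂ) :
    quotAntipode h hDE (algebraMap ℂ _ c) = algebraMap ℂ _ c := by
  simp [quotAntipode]

/-- The Hopf algebra structure on the algebra presented by `r`, with `Δ(a_ij) = ∑ a_ik ⊗ a_kj` and
`ε(a_ij) = δ_ij`. -/
noncomputable abbrev quotHopf (h : Presents r E D) (hDE : D * E = 1) :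
    HopfAlgebra ℂ (RingQuot r) where
  toBialgebra := quotBialgebra h
  antipode := quotAntipode h hDE
  mul_antipode_rTensor_comul := by
    have key : ∀ (c : ℂ) (u v : RingQuot r ⊗[ℂ] RingQuot r),
        LinearMap.mul' ℂ _ ((quotAntipode h hDE).rTensor _ u) = algebraMap ℂ _ c →
        LinearMap.mul' ℂ _ ((quotAntipode h hDE).rTensor _ (u * v)) =
          c • LinearMap.mul' ℂ _ ((quotAntipode h hDE).rTensor _ v) := by
      intro c u v hu
      induction v using TensorProduct.induction_on with
      | zero => simp
      | add v w hv hw => rw [mul_add, map_add, map_add, hv, hw, map_add, map_add, smul_add]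
      | tmul y z =>
        have : ∀ u : RingQuot r ⊗[ℂ] RingQuot r,
            LinearMap.mul' ℂ _ ((quotAntipode h hDE).rTensor _ (u * y ⊗ₜ[ℂ] z)) =
              quotAntipode h hDE y *
                LinearMap.mul' ℂ _ ((quotAntipode h hDE).rTensor _ u) * z := by
          intro u
          induction u using TensorProduct.induction_on with
          | zero => simp
          | add v w hv hw => rw [add_mul, map_add, map_add, hv, hw, map_add, map_add, mul_add,
              add_mul]
          | tmul s t => simp [quotAntipode_mul, mul_assoc]
        rw [this, hu]
        simp [Algebra.algebraMap_eq_smul_one]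
    have main : ∀ x : RingQuot r,
        LinearMap.mul' ℂ _ ((quotAntipode h hDE).rTensor _ (quotComul h x)) =
          algebraMap ℂ _ (quotCounit h x) := by
      intro x
      induction x using quot_induction with
      | hs c => simp [Algebra.TensorProduct.algebraMap_apply, quotAntipode_algebraMap]
      | hg p =>
        obtain ⟨i, j⟩ := p
        have := antiGen_mul h hDE i j
        rw [quotComul_gen, quotCounit_gen, map_sum, map_sum]
        simp only [LinearMap.rTensor_tmul, LinearMap.mul'_apply, quotAntipode_gen, this]
        split_ifs <;> simp
      | ha x y hx hy => simp only [map_add, hx, hy]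
      | hm x y hx hy => rw [map_mul, key _ _ _ hx, hy, map_mul, map_mul, Algebra.smul_def]
    exact LinearMap.ext main
  mul_antipode_lTensor_comul := by
    have key : ∀ (c : ℂ) (u v : RingQuot r ⊗[ℂ] RingQuot r),
        LinearMap.mul' ℂ _ ((quotAntipode h hDE).lTensor _ v) = algebraMap ℂ _ c →
        LinearMap.mul' ℂ _ ((quotAntipode h hDE).lTensor _ (u * v)) =
          c • LinearMap.mul' ℂ _ ((quotAntipode h hDE).lTensor _ u) := by
      intro c u v hv
      induction u using TensorProduct.induction_on with
      | zero => simp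
      | add u w hu hw => rw [add_mul, map_add, map_add, hu, hw, map_add, map_add, smul_add]
      | tmul y z =>
        have : ∀ v : RingQuot r ⊗[ℂ] RingQuot r,
            LinearMap.mul' ℂ _ ((quotAntipode h hDE).lTensor _ (y ⊗ₜ[ℂ] z * v)) =
              y * LinearMap.mul' ℂ _ ((quotAntipode h hDE).lTensor _ v) *
                quotAntipode h hDE z := by
          intro v
          induction v using TensorProduct.induction_on with
          | zero => simp
          | add v w hv hw => rw [mul_add, map_add, map_add, hv, hw, map_add, map_add, mul_add,
              add_mul]
          | tmul s t => simp [quotAntipode_mul, mul_assoc]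
        rw [this, hv]
        simp [Algebra.algebraMap_eq_smul_one]
    have main : ∀ x : RingQuot r,
        LinearMap.mul' ℂ _ ((quotAntipode h hDE).lTensor _ (quotComul h x)) =
          algebraMap ℂ _ (quotCounit h x) := by
      intro x
      induction x using quot_induction with
      | hs c =>
        have := quotAntipode_algebraMap h hDE 1
        rw [map_one] at this
        simp [Algebra.TensorProduct.algebraMap_apply, this]
      | hg p =>
        obtain ⟨i, j⟩ := p
        have := mul_antiGen h hDE i j
        rw [quotComul_gen, quotCounit_gen, map_sum, map_sum]
        simp only [LinearMap.lTensor_tmul, LinearMap.mul'_apply, quotAntipode_gen, this]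
        split_ifs <;> simp
      | ha x y hx hy => simp only [map_add, hx, hy]
      | hm x y hx hy =>
        rw [map_mul, key _ _ _ hy, hx, map_mul, map_mul, Algebra.smul_def,
          Algebra.commutes]
    exact LinearMap.ext main

end Construction

/-- The four free generators `a = a_11`, `b = a_12`, `c = a_21`, `d = a_22`. -/
noncomputable abbrev wa : FreeAlgebra ℂ (Fin 2 × Fin 2) := FreeAlgebra.ι ℂ (0, 0)
/-- see `wa` -/
noncomputable abbrev wb : FreeAlgebra ℂ (Fin 2 × Fin 2) := FreeAlgebra.ι ℂ (0, 1)
/-- see `wa` -/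
noncomputable abbrev wc : FreeAlgebra ℂ (Fin 2 × Fin 2) := FreeAlgebra.ι ℂ (1, 0)
/-- see `wa` -/
noncomputable abbrev wd : FreeAlgebra ℂ (Fin 2 × Fin 2) := FreeAlgebra.ι ℂ (1, 1)

/-- The relations of `SL_q(2)`. -/
inductive SLqRel (q : ℂˣ) :
    FreeAlgebra ℂ (Fin 2 × Fin 2) → FreeAlgebra ℂ (Fin 2 × Fin 2) → Prop
  | ab : SLqRel q (wa * wb) ((q : ℂ)⁻¹ • (wb * wa))
  | ac : SLqRel q (wa * wc) ((q : ℂ)⁻¹ • (wc * wa))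
  | bd : SLqRel q (wb * wd) ((q : ℂ)⁻¹ • (wd * wb))
  | cd : SLqRel q (wc * wd) ((q : ℂ)⁻¹ • (wd * wc))
  | bc : SLqRel q (wb * wc) (wc * wb)
  | ad : SLqRel q (wa * wd - (q : ℂ)⁻¹ • (wb * wc)) 1
  | da : SLqRel q (wd * wa - (q : ℂ) • (wb * wc)) 1

/-- The relations of Woronowicz's exceptional quantum group. -/
inductive ExcRel (τ : ℂˣ) :
    FreeAlgebra ℂ (Fin 2 × Fin 2) → FreeAlgebra ℂ (Fin 2 × Fin 2) → Prop
  | r1 : ExcRel τ ((τ : ℂ) • (wa * wa) - wb * wa + wa * wb) ((τ : ℂ) • 1)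
  | r2 : ExcRel τ ((τ : ℂ) • (wd * wd) - wb * wd + wd * wb) ((τ : ℂ) • 1)
  | r3 : ExcRel τ ((τ : ℂ) • (wa * wc) - wb * wc + wa * wd) 1
  | r4 : ExcRel τ ((τ : ℂ) • (wd * wc) - wb * wc + wd * wa) 1
  | r5 : ExcRel τ ((τ : ℂ) • (wc * wa) - wd * wa + wc * wb) (-1)
  | r6 : ExcRel τ ((τ : ℂ) • (wc * wd) - wa * wd + wc * wb) (-1)
  | r7 : ExcRel τ ((τ : ℂ) • (wc * wc) - wd * wc + wc * wd) 0
  | r8 : ExcRel τ ((τ : ℂ) • (wc * wc) - wa * wc + wc * wa) 0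

theorem SLqRel.presents (q : ℂˣ) :
    Presents (SLqRel q) !![0, 1; -(q : ℂ)⁻¹, 0] !![0, -(q : ℂ); 1, 0] := by
  intro R _ _ x
  have hq : (q : ℂ) ≠ 0 := q.ne_zero
  constructor
  · intro h
    have ab := h _ _ .ab
    have ac := h _ _ .ac
    have bd := h _ _ .bd
    have cd := h _ _ .cd
    have bc := h _ _ .bc
    have ad := h _ _ .ad
    have da := h _ _ .da
    simp only [map_mul, map_smul, map_sub, map_one, FreeAlgebra.lift_ι_apply] at *
    rw [sub_eq_iff_eq_add] at ad da
    simp only [QuadRel, Fin.forall_fin_two, Fin.sum_univ_two, Matrix.of_apply, Matrix.cons_val',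
      Matrix.cons_val_zero, Matrix.cons_val_one, Matrix.cons_val_fin_one, zero_smul, zero_add,
      add_zero, one_smul, neg_smul, ab, ac, bd, cd, ad, da, ← bc, smul_add, smul_smul,
      mul_inv_cancel₀ hq, inv_mul_cancel₀ hq]
    refine ⟨⟨⟨?_, ?_⟩, ?_, ?_⟩, ⟨?_, ?_⟩, ?_, ?_⟩ <;> abel
  · rintro ⟨h1, h2⟩ u v huv
    simp only [Fin.forall_fin_two, Fin.sum_univ_two, Matrix.of_apply, Matrix.cons_val',
      Matrix.cons_val_zero, Matrix.cons_val_one, Matrix.cons_val_fin_one, zero_smul, zero_add,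
      add_zero, one_smul, neg_smul] at h1 h2
    obtain ⟨⟨e11, e12⟩, e21, e22⟩ := h1
    obtain ⟨⟨f11, f12⟩, f21, f22⟩ := h2
    have hbc : x (0, 1) * x (1, 0) = x (1, 0) * x (0, 1) := by
      have := congrArg (fun w => (q : ℂ) • w) e12
      simp only [smul_add, smul_neg, smul_smul, mul_inv_cancel₀ hq, one_smul] at this
      have h3 := congrArg₂ (· + ·) f12 this
      rw [← sub_eq_zero]
      have h4 : -((q : ℂ) • (x (0, 0) * x (1, 1))) + x (0, 1) * x (1, 0) +
        ((q : ℂ) • (x (0, 0) * x (1, 1)) + -(x (1, 0) * x (0, 1))) =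
          x (0, 1) * x (1, 0) - x (1, 0) * x (0, 1) := by abel
      rw [← h4, h3]
      simp
    cases huv <;> simp only [map_mul, map_smul, map_sub, map_one, FreeAlgebra.lift_ι_apply]
    · have := congrArg (fun w => (q : ℂ)⁻¹ • w) f11
      simp only [smul_add, smul_neg, smul_smul, inv_mul_cancel₀ hq, one_smul, smul_zero] at this
      exact (neg_add_eq_zero.1 this)
    · exact add_neg_eq_zero.1 e11
    · exact add_neg_eq_zero.1 e22
    · have := congrArg (fun w => (q : ℂ)⁻¹ • w) f22
      simp only [smul_add, smul_neg, smul_smul, inv_mul_cancel₀ hq, one_smul, smul_zero] at this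
      exact (neg_add_eq_zero.1 this)
    · exact hbc
    · rw [hbc, sub_eq_add_neg]; exact e12
    · rw [hbc, sub_eq_add_neg, add_comm]; exact f21

theorem ExcRel.presents (τ : ℂˣ) :
    Presents (ExcRel τ) !![0, -1; 1, (τ : ℂ)] !![(τ : ℂ), 1; -1, 0] := by
  intro R _ _ x
  constructor
  · intro h
    have r1 := h _ _ .r1
    have r2 := h _ _ .r2
    have r3 := h _ _ .r3
    have r4 := h _ _ .r4
    have r5 := h _ _ .r5
    have r6 := h _ _ .r6
    have r7 := h _ _ .r7
    have r8 := h _ _ .r8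
    simp only [map_mul, map_smul, map_sub, map_add, map_neg, map_zero, map_one,
      FreeAlgebra.lift_ι_apply] at *
    simp only [QuadRel, Fin.forall_fin_two, Fin.sum_univ_two, Matrix.of_apply, Matrix.cons_val',
      Matrix.cons_val_zero, Matrix.cons_val_one, Matrix.cons_val_fin_one, zero_smul, zero_add,
      add_zero, one_smul, neg_smul]
    refine ⟨⟨⟨?_, ?_⟩, ?_, ?_⟩, ⟨?_, ?_⟩, ?_, ?_⟩
    · rw [← r8]; abel
    · rw [← r6]; abel
    · rw [← r4]; abel
    · rw [← r2]; abel
    · rw [← r1]; abel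
    · rw [← r3]; abel
    · rw [← r5]; abel
    · rw [← r7]; abel
  · rintro ⟨h1, h2⟩ u v huv
    simp only [Fin.forall_fin_two, Fin.sum_univ_two, Matrix.of_apply, Matrix.cons_val',
      Matrix.cons_val_zero, Matrix.cons_val_one, Matrix.cons_val_fin_one, zero_smul, zero_add,
      add_zero, one_smul, neg_smul] at h1 h2
    obtain ⟨⟨e11, e12⟩, e21, e22⟩ := h1
    obtain ⟨⟨f11, f12⟩, f21, f22⟩ := h2
    cases huv <;> simp only [map_mul, map_smul, map_sub, map_add, map_neg, map_zero, map_one,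
      FreeAlgebra.lift_ι_apply]
    · rw [← f11]; abel
    · rw [← e22]; abel
    · rw [← f12]; abel
    · rw [← e21]; abel
    · rw [← f21]; abel
    · rw [← e12]; abel
    · rw [← f22]; abel
    · rw [← e11]; abel

/-- The quantum group `SL_q(2)`: the algebra generated by `a, b, c, d` with the relations
`ab = q⁻¹ba`, `ac = q⁻¹ca`, `bd = q⁻¹db`, `cd = q⁻¹dc`, `bc = cb`, `ad - q⁻¹bc = da - qbc = 1`. -/
abbrev SLq (q : ℂˣ) : Type := RingQuot (SLqRel q)

/-- Woronowicz's exceptional quantum group, given by generators and relations. -/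
abbrev Exc (τ : ℂˣ) : Type := RingQuot (ExcRel τ)

noncomputable instance SLq.instHopfAlgebra (q : ℂˣ) : HopfAlgebra ℂ (SLq q) :=
  quotHopf (SLqRel.presents q) (by
    ext i j; fin_cases i <;> fin_cases j <;> simp [Matrix.mul_apply])

noncomputable instance Exc.instHopfAlgebra (τ : ℂˣ) : HopfAlgebra ℂ (Exc τ) :=
  quotHopf (ExcRel.presents τ) (by
    ext i j; fin_cases i <;> fin_cases j <;> simp [Matrix.mul_apply])

theorem SLq.comul_gen (q : ℂˣ) (i j : Fin 2) :
    Coalgebra.comul (R := ℂ) (quotGen (SLqRel q) (i, j)) =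
      ∑ m, quotGen (SLqRel q) (i, m) ⊗ₜ[ℂ] quotGen (SLqRel q) (m, j) :=
  quotComul_gen (SLqRel.presents q) i j

theorem Exc.comul_gen (τ : ℂˣ) (i j : Fin 2) :
    Coalgebra.comul (R := ℂ) (quotGen (ExcRel τ) (i, j)) =
      ∑ m, quotGen (ExcRel τ) (i, m) ⊗ₜ[ℂ] quotGen (ExcRel τ) (m, j) :=
  quotComul_gen (ExcRel.presents τ) i j

/-! ### Congruence of matrices -/

/-- `E` and `E'` lie in the same orbit of the action `E ↦ ᵗT E T` of `GL_2(ℂ)`. -/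
def MatCongruent (E E' : Matrix (Fin 2) (Fin 2) ℂ) : Prop :=
  ∃ T : GL (Fin 2) ℂ, E' = (T : Matrix (Fin 2) (Fin 2) ℂ)ᵀ * E * (T : Matrix (Fin 2) (Fin 2) ℂ)

/-- The stabilizer of `E` under the action `E ↦ ᵗT E T` of `GL_2(ℂ)`. -/
def congStabilizer (E : Matrix (Fin 2) (Fin 2) ℂ) : Subgroup (GL (Fin 2) ℂ) where
  carrier := {T | (T : Matrix (Fin 2) (Fin 2) ℂ)ᵀ * E * (T : Matrix (Fin 2) (Fin 2) ℂ) = E}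
  one_mem' := by simp
  mul_mem' := by
    intro S T hS hT
    simp only [Set.mem_ofPred_eq, Units.val_mul, Matrix.transpose_mul] at *
    calc _ = (T : Matrix (Fin 2) (Fin 2) ℂ)ᵀ * ((S : Matrix (Fin 2) (Fin 2) ℂ)ᵀ * E * S.val) *
          T.val := by simp only [Matrix.mul_assoc]
      _ = E := by rw [hS, hT]
  inv_mem' := by
    intro T hT
    simp only [Set.mem_ofPred_eq] at *
    have h : T.val * (T⁻¹).val = 1 := T.mul_inv
    have h' : (T⁻¹).valᵀ * T.valᵀ = 1 := by rw [← Matrix.transpose_mul, h, Matrix.transpose_one]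
    calc _ = (T⁻¹).valᵀ * (T.valᵀ * E * T.val) * (T⁻¹).val := by rw [hT]
      _ = ((T⁻¹).valᵀ * T.valᵀ) * E * (T.val * (T⁻¹).val) := by simp only [Matrix.mul_assoc]
      _ = E := by rw [h, h', Matrix.one_mul, Matrix.mul_one]

/-- `Θ(E) = E⁻¹ ᵗE`. -/
noncomputable def Theta (E : Matrix (Fin 2) (Fin 2) ℂ) : Matrix (Fin 2) (Fin 2) ℂ := E⁻¹ * Eᵀ

/-- The representative `E_q` of a generic orbit. -/
noncomputable def genericForm (q : ℂˣ) : Matrix (Fin 2) (Fin 2) ℂ := !![0, 1; -(q : ℂ)⁻¹, 0]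

/-- The representative of the singular orbit. -/
def singularForm : Matrix (Fin 2) (Fin 2) ℂ := !![1, 1; -1, 0]

/-- The action of the group with two elements on `ℂˣ` by inversion. -/
def inversionAction : Multiplicative (ZMod 2) →* MulAut ℂˣ where
  toFun k := if k = 1 then 1 else MulEquiv.inv ℂˣ
  map_one' := by simp
  map_mul' := by
    have h : MulEquiv.inv ℂˣ * MulEquiv.inv ℂˣ = (1 : MulAut ℂˣ) := by ext; simp
    have hk : ∀ k : Multiplicative (ZMod 2), k = 1 ∨ k = Multiplicative.ofAdd 1 := by decide
    have h1 : (Multiplicative.ofAdd 1 : Multiplicative (ZMod 2)) ≠ 1 := by decide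
    have h2 : (Multiplicative.ofAdd 1 * Multiplicative.ofAdd 1 : Multiplicative (ZMod 2)) = 1 := by
      decide
    intro k l
    rcases hk k with rfl | rfl <;> rcases hk l with rfl | rfl <;> simp [h1, h2, h]

/-!
Everything about a two-dimensional fiber functor `F` is encoded in the matrix `E` of its form in a
basis of `F(X)`.

* A basis of `F(X)` gives, by multiplicativity, a basis of each `F(X^{⊗ n})` indexed by words of
  length `n` in two letters (`FiberFunctor.wordBasis`). In these bases `F` acts on a tangle by a
  matrix which is computed from the matrices `E` of the arc `ε` and `D` of the arc `δ`
  (`interp`, `FiberFunctor.map_wordBasis`). Straightening a bent string says `D = E⁻¹`, and a closed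
  loop says `∑ D_ij E_ij = d`, that is, `tr Θ(E) = d`. Hence `F` is determined by `E` up to
  equivalence (`FiberFunctor.equivalent_of_hasForm`), and equivalence classes correspond to
  congruence classes of matrices `E` with `tr Θ(E) = d`. Conversely the matrices attached to an
  invertible `E` respect all relations between tangles (`interp_eq_of_rel`), which gives a fiber
  functor with the form `E` (`stdFiberFunctor`).

* Over `ℂ` a binary form has an isotropic vector, so `E` is congruent to a matrix with one vanishing
  diagonal entry; completing it to an antidiagonal matrix fails exactly for the class of `E_s`
  (`matCongruent_genericForm_or_singularForm`). Since `Θ(E)` changes by conjugation under congruence,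
  its trace `-(q + q⁻¹)` distinguishes the orbits of the `E_q`, and `Θ(E_s)` is not diagonalizable.

* A natural transformation `F → F ⊗ B` is a family of coefficients `s_{v u} ∈ B`, for words `v, u` of
  the same length, that is, a linear map on the free algebra in four generators, whose monomials
  are indexed by such pairs. Naturality with respect to an arc with parallel strings on both sides
  says that this linear map vanishes on the products `p (∑ E_kl x_ki x_lj - E_ij) q` and on the
  corresponding products for `D`. So the algebra presented by these quadratic relations carries the
  universal transformation (`FiberFunctor.HasForm.isAssociatedHopfAlgebra`). For `E_q` these are the
  relations of `SL_q(2)`, and for a matrix congruent to `E_s` those of Woronowicz.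
-/

/-! ### Congruence classes of invertible matrices -/

theorem MatCongruent.of_det_ne_zero {E E' : Matrix (Fin 2) (Fin 2) ℂ}
    (T : Matrix (Fin 2) (Fin 2) ℂ) (hT : T.det ≠ 0) (h : Tᵀ * E * T = E') : MatCongruent E E' :=
  ⟨Matrix.GeneralLinearGroup.mkOfDetNeZero T hT, h.symm⟩

theorem MatCongruent.refl (E : Matrix (Fin 2) (Fin 2) ℂ) : MatCongruent E E :=
  ⟨1, by simp⟩

theorem MatCongruent.trans {E E' E'' : Matrix (Fin 2) (Fin 2) ℂ} (h : MatCongruent E E')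
    (h' : MatCongruent E' E'') : MatCongruent E E'' := by
  obtain ⟨S, rfl⟩ := h
  obtain ⟨T, rfl⟩ := h'
  exact ⟨S * T, by simp only [Units.val_mul, Matrix.transpose_mul, Matrix.mul_assoc]⟩

theorem MatCongruent.symm {E E' : Matrix (Fin 2) (Fin 2) ℂ} (h : MatCongruent E E') :
    MatCongruent E' E := by
  obtain ⟨T, rfl⟩ := h
  refine ⟨T⁻¹, ?_⟩
  have h : T.val * (T⁻¹).val = 1 := T.mul_inv
  have h' : (T⁻¹).valᵀ * T.valᵀ = 1 := by rw [← Matrix.transpose_mul, h, Matrix.transpose_one]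
  calc E = ((T⁻¹).valᵀ * T.valᵀ) * E * (T.val * (T⁻¹).val) := by
        rw [h, h', Matrix.one_mul, Matrix.mul_one]
    _ = _ := by simp only [Matrix.mul_assoc]

/-- The operator `Θ(E)` of a form is transformed by conjugation. -/
theorem MatCongruent.exists_theta_eq {E E' : Matrix (Fin 2) (Fin 2) ℂ} (h : MatCongruent E E') :
    ∃ T : GL (Fin 2) ℂ, Theta E' = (T⁻¹).val * Theta E * T.val := by
  obtain ⟨T, rfl⟩ := h
  refine ⟨T, ?_⟩
  have h : (T⁻¹).valᵀ * T.valᵀ = 1 := by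
    rw [← Matrix.transpose_mul, T.mul_inv, Matrix.transpose_one]
  have h' : (T.valᵀ)⁻¹ = (T⁻¹).valᵀ := Matrix.inv_eq_left_inv h
  rw [Theta, Theta, Matrix.mul_inv_rev, Matrix.mul_inv_rev, h', Matrix.transpose_mul,
    Matrix.transpose_mul, Matrix.transpose_transpose, ← Matrix.coe_units_inv]
  calc _ = (T⁻¹).val * E⁻¹ * ((T⁻¹).valᵀ * T.valᵀ) * Eᵀ * T.val := by
        simp only [Matrix.mul_assoc]
    _ = _ := by rw [h, Matrix.mul_one]; simp only [Matrix.mul_assoc]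

theorem MatCongruent.trace_theta_eq {E E' : Matrix (Fin 2) (Fin 2) ℂ} (h : MatCongruent E E') :
    (Theta E').trace = (Theta E).trace := by
  obtain ⟨T, hT⟩ := h.exists_theta_eq
  rw [hT, Matrix.trace_mul_comm, ← Matrix.mul_assoc, T.mul_inv, Matrix.one_mul]

theorem isUnit_det_genericForm (q : ℂˣ) : IsUnit (genericForm q).det := by
  simp [genericForm, Matrix.det_fin_two_of]

theorem theta_genericForm (q : ℂˣ) :
    Theta (genericForm q) = -!![(q : ℂ), 0; 0, (q : ℂ)⁻¹] := by
  have h : (genericForm q)⁻¹ = !![0, -(q : ℂ); 1, 0] := by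
    refine Matrix.inv_eq_left_inv ?_
    ext i j; fin_cases i <;> fin_cases j <;> simp [genericForm, Matrix.mul_apply]
  rw [Theta, h]
  ext i j; fin_cases i <;> fin_cases j <;> simp [genericForm, Matrix.mul_apply]

theorem trace_theta_genericForm (q : ℂˣ) :
    (Theta (genericForm q)).trace = -((q : ℂ) + (q : ℂ)⁻¹) := by
  rw [theta_genericForm]
  simp [Matrix.trace_fin_two, add_comm]

theorem isUnit_det_singularForm : IsUnit singularForm.det := by
  simp [singularForm, Matrix.det_fin_two_of]

theorem theta_singularForm : Theta singularForm = !![-1, 0; 2, -1] := by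
  have h : singularForm⁻¹ = !![0, -1; 1, 1] := by
    refine Matrix.inv_eq_left_inv ?_
    ext i j; fin_cases i <;> fin_cases j <;> simp [singularForm, Matrix.mul_apply]
  rw [Theta, h]
  ext i j
  fin_cases i <;> fin_cases j <;> simp [singularForm, Matrix.mul_apply]
  norm_num

theorem eq_or_eq_inv_of_add_inv_eq {q q' : ℂˣ}
    (h : (q : ℂ) + (q : ℂ)⁻¹ = (q' : ℂ) + (q' : ℂ)⁻¹) : q' = q ∨ q' = q⁻¹ := by
  have hq := q.ne_zero
  have hq' := q'.ne_zero
  have h' : ((q' : ℂ) - q) * ((q : ℂ) * q' - 1) = 0 := by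
    field_simp at h
    linear_combination -h
  rcases mul_eq_zero.1 h' with h | h
  · exact Or.inl (Units.ext (sub_eq_zero.1 h))
  · refine Or.inr (eq_inv_of_mul_eq_one_right (Units.ext ?_))
    simpa using sub_eq_zero.1 h

theorem matCongruent_genericForm_inv (q : ℂˣ) :
    MatCongruent (genericForm q) (genericForm q⁻¹) := by
  refine .of_det_ne_zero !![0, 1; -(q : ℂ), 0] (by simp [Matrix.det_fin_two_of]) ?_
  ext i j
  fin_cases i <;> fin_cases j <;> simp [genericForm, Matrix.mul_apply]

theorem matCongruent_genericForm_iff (q q' : ℂˣ) :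
    MatCongruent (genericForm q) (genericForm q') ↔ q' = q ∨ q' = q⁻¹ := by
  constructor
  · intro h
    have := h.trace_theta_eq
    rw [trace_theta_genericForm, trace_theta_genericForm, neg_inj] at this
    exact eq_or_eq_inv_of_add_inv_eq this.symm
  · rintro (rfl | rfl)
    · exact .refl _
    · exact matCongruent_genericForm_inv q

/-- `Θ(E_s)` has trace `-2` but is not `-1`, while `Θ(E_q)` has trace `-2` only if it is `-1`. -/
theorem not_matCongruent_genericForm_singularForm (q : ℂˣ) :
    ¬ MatCongruent (genericForm q) singularForm := by
  intro h
  have ht := h.trace_theta_eq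
  obtain ⟨T, hT⟩ := h.exists_theta_eq
  rw [trace_theta_genericForm, theta_singularForm] at ht
  have hq : (q : ℂ) + (q : ℂ)⁻¹ = ((1 : ℂˣ) : ℂ) + ((1 : ℂˣ) : ℂ)⁻¹ := by
    simp [Matrix.trace_fin_two] at ht ⊢
    linear_combination ht
  obtain rfl : q = 1 := by
    rcases eq_or_eq_inv_of_add_inv_eq hq with h | h
    · exact h.symm
    · exact inv_eq_one.1 h.symm
  have h1 : Theta (genericForm 1) = -1 := by
    rw [theta_genericForm]
    ext i j; fin_cases i <;> fin_cases j <;> simp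
  rw [h1, theta_singularForm, Matrix.mul_neg, Matrix.mul_one, Matrix.neg_mul, T.inv_mul] at hT
  have := congrFun (congrFun hT 1) 0
  simp at this

/-- A nondegenerate form with an isotropic second basis vector. -/
theorem matCongruent_of_isotropic {a b c : ℂ} (hb : b ≠ 0) (hc : c ≠ 0) :
    (∃ q : ℂˣ, MatCongruent !![a, b; c, 0] (genericForm q)) ∨
      MatCongruent !![a, b; c, 0] singularForm := by
  have scale : ∃ q : ℂˣ, MatCongruent !![0, b; c, 0] (genericForm q) := by
    refine ⟨Units.mk0 (-(b / c)) (by simp [hb, hc]),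
      .of_det_ne_zero !![b⁻¹, 0; 0, 1] (by simp [Matrix.det_fin_two_of, hb]) ?_⟩
    ext i j
    fin_cases i <;> fin_cases j <;> simp [genericForm, Matrix.mul_apply, hb]
    field_simp
  by_cases h : b + c = 0
  · obtain rfl : c = -b := by linear_combination h
    by_cases ha : a = 0
    · subst ha; exact Or.inl scale
    · right
      obtain ⟨s, hs⟩ := IsAlgClosed.exists_eq_mul_self a⁻¹
      have hs0 : s ≠ 0 := by rintro rfl; simp [ha] at hs
      refine .of_det_ne_zero !![s, 0; 0, (s * b)⁻¹]
        (by simp [Matrix.det_fin_two_of, hb, hs0]) ?_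
      have hs' : s * a * s = 1 := by
        rw [mul_right_comm, ← hs, inv_mul_cancel₀ ha]
      ext i j
      fin_cases i <;> fin_cases j <;> simp [singularForm, Matrix.mul_apply, hs'] <;> field_simp
  · -- adding `-a / (b + c)` times the second basis vector makes the first one isotropic
    left
    obtain ⟨q, hq⟩ := scale
    refine ⟨q, MatCongruent.trans ?_ hq⟩
    refine .of_det_ne_zero !![1, 0; -(a / (b + c)), 1] (by simp [Matrix.det_fin_two_of]) ?_
    ext i j
    fin_cases i <;> fin_cases j <;> simp [Matrix.mul_apply]
    field_simp
    ring

/-- Over `ℂ` every binary form has an isotropic vector, which reduces the classification to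
`matCongruent_of_isotropic`. -/
theorem matCongruent_genericForm_or_singularForm {E : Matrix (Fin 2) (Fin 2) ℂ}
    (hE : IsUnit E.det) :
    (∃ q : ℂˣ, MatCongruent (genericForm q) E) ∨ MatCongruent singularForm E := by
  obtain ⟨a, b, c, h⟩ : ∃ a b c : ℂ, MatCongruent E !![a, b; c, 0] := by
    by_cases h : E 1 1 = 0
    · refine ⟨E 0 0, E 0 1, E 1 0, ?_⟩
      rw [← h, ← Matrix.eta_fin_two E]
      exact .refl E
    · obtain ⟨s, hs⟩ := IsAlgClosed.exists_eq_mul_self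
        (discrim (E 1 1) (E 0 1 + E 1 0) (E 0 0))
      obtain ⟨t, ht⟩ := exists_quadratic_eq_zero h ⟨s, hs⟩
      obtain ⟨M, hM⟩ : ∃ M, !![0, 1; 1, t]ᵀ * E * !![0, 1; 1, t] = M := ⟨_, rfl⟩
      have e : M 1 1 = 0 := by
        rw [← hM]
        simp [Matrix.mul_apply]
        linear_combination ht
      refine ⟨M 0 0, M 0 1, M 1 0, .of_det_ne_zero !![0, 1; 1, t]
        (by simp [Matrix.det_fin_two_of]) ?_⟩
      rw [hM, Matrix.eta_fin_two M, e]
      rfl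
  have hdet : (!![a, b; c, 0] : Matrix (Fin 2) (Fin 2) ℂ).det ≠ 0 := by
    obtain ⟨T, hT⟩ := h
    rw [hT, Matrix.det_mul, Matrix.det_mul, Matrix.det_transpose]
    have hT' : T.val.det ≠ 0 := ((Matrix.isUnit_iff_isUnit_det _).1 T.isUnit).ne_zero
    exact mul_ne_zero (mul_ne_zero hT' hE.ne_zero) hT'
  have hbc : b ≠ 0 ∧ c ≠ 0 := by
    rw [Matrix.det_fin_two_of] at hdet
    constructor <;> rintro rfl <;> simp at hdet
  rcases matCongruent_of_isotropic (a := a) hbc.1 hbc.2 with ⟨q, hq⟩ | hs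
  · exact Or.inl ⟨q, (h.trans hq).symm⟩
  · exact Or.inr (h.trans hs).symm

/-! ### Stabilizers -/

theorem mem_congStabilizer {E : Matrix (Fin 2) (Fin 2) ℂ} {T : GL (Fin 2) ℂ} :
    T ∈ congStabilizer E ↔ T.valᵀ * E * T.val = E := Iff.rfl

theorem nonempty_mulEquiv_of_injective {G M : Type*} [Group G] [Group M] {H : Subgroup M}
    (f : G →* M) (hf : Function.Injective f) (h : ∀ x, x ∈ H ↔ ∃ g, f g = x) :
    Nonempty (H ≃* G) := by
  obtain rfl : H = f.range := Subgroup.ext h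
  exact ⟨(MonoidHom.ofInjective hf).symm⟩

/-- The homomorphism from the group with two elements given by an involution. -/
def involutionHom {M : Type*} [Group M] (s : M) (hs : s * s = 1) :
    Multiplicative (ZMod 2) →* M where
  toFun k := if k = 1 then 1 else s
  map_one' := by simp
  map_mul' := by
    have hk : ∀ k : Multiplicative (ZMod 2), k = 1 ∨ k = Multiplicative.ofAdd 1 := by decide
    have h1 : (Multiplicative.ofAdd 1 : Multiplicative (ZMod 2)) ≠ 1 := by decide
    have h2 : (Multiplicative.ofAdd 1 * Multiplicative.ofAdd 1 : Multiplicative (ZMod 2)) = 1 := by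
      decide
    intro k l
    rcases hk k with rfl | rfl <;> rcases hk l with rfl | rfl <;> simp [h1, h2, hs]

theorem multiplicative_zmod_two_cases (k : Multiplicative (ZMod 2)) :
    k = 1 ∨ k = Multiplicative.ofAdd 1 := by
  revert k; decide

/-- The diagonal matrices `diag(t, t⁻¹)`. -/
noncomputable def diagHom : ℂˣ →* GL (Fin 2) ℂ where
  toFun t := .mkOfDetNeZero !![(t : ℂ), 0; 0, (t : ℂ)⁻¹] (by simp [Matrix.det_fin_two_of])
  map_one' := by
    ext i j; fin_cases i <;> fin_cases j <;> simp [Matrix.GeneralLinearGroup.mkOfDetNeZero]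
  map_mul' s t := by
    ext i j
    fin_cases i <;> fin_cases j <;>
      simp [Matrix.GeneralLinearGroup.mkOfDetNeZero, Matrix.mul_apply, mul_comm]

theorem diagHom_val (t : ℂˣ) : (diagHom t).val = !![(t : ℂ), 0; 0, (t : ℂ)⁻¹] := rfl

theorem diagHom_injective : Function.Injective diagHom := by
  intro s t h
  have := congrArg (fun T : GL (Fin 2) ℂ => T.val 0 0) h
  exact Units.ext (by simpa [diagHom_val] using this)

/-- The condition `ᵗT E T = E` in terms of the entries of `T`. -/
theorem transpose_mul_mul_eq_iff {M : Matrix (Fin 2) (Fin 2) ℂ} {a c : ℂ} :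
    Mᵀ * !![a, 1; c, 0] * M = !![a, 1; c, 0] ↔
      (a * M 0 0 ^ 2 + (1 + c) * (M 0 0 * M 1 0) = a ∧
        a * (M 0 0 * M 0 1) + M 0 0 * M 1 1 + c * (M 1 0 * M 0 1) = 1) ∧
      a * (M 0 0 * M 0 1) + M 0 1 * M 1 0 + c * (M 0 0 * M 1 1) = c ∧
        a * M 0 1 ^ 2 + (1 + c) * (M 0 1 * M 1 1) = 0 := by
  rw [← Matrix.ext_iff]
  simp only [Fin.forall_fin_two, Matrix.mul_apply, Fin.sum_univ_two, Matrix.transpose_apply,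
    Matrix.of_apply, Matrix.cons_val', Matrix.cons_val_zero, Matrix.cons_val_one,
    Matrix.cons_val_fin_one]
  refine and_congr (and_congr ?_ ?_) (and_congr ?_ ?_) <;> ring_nf

theorem mem_congStabilizer_genericForm {q : ℂˣ} {T : GL (Fin 2) ℂ} :
    T ∈ congStabilizer (genericForm q) ↔
      ((1 - (q : ℂ)⁻¹) * (T.val 0 0 * T.val 1 0) = 0 ∧
        T.val 0 0 * T.val 1 1 - (q : ℂ)⁻¹ * (T.val 1 0 * T.val 0 1) = 1) ∧
      T.val 0 1 * T.val 1 0 - (q : ℂ)⁻¹ * (T.val 0 0 * T.val 1 1) = -(q : ℂ)⁻¹ ∧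
        (1 - (q : ℂ)⁻¹) * (T.val 0 1 * T.val 1 1) = 0 := by
  rw [mem_congStabilizer, genericForm, transpose_mul_mul_eq_iff]
  simp only [zero_mul, zero_add, neg_mul, ← sub_eq_add_neg]

theorem mem_congStabilizer_genericForm_iff {q : ℂˣ} (h1 : q ≠ 1) (h2 : q ≠ -1)
    (T : GL (Fin 2) ℂ) : T ∈ congStabilizer (genericForm q) ↔
      ∃ t : ℂˣ, T.val = !![(t : ℂ), 0; 0, (t : ℂ)⁻¹] := by
  rw [mem_congStabilizer_genericForm]
  constructor
  · rintro ⟨⟨e1, e2⟩, e3, e4⟩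
    have hq := q.ne_zero
    have h1' : 1 - (q : ℂ)⁻¹ ≠ 0 := fun h => h1 (Units.ext
      (inv_eq_one.1 (sub_eq_zero.1 h).symm))
    have h2' : 1 + (q : ℂ)⁻¹ ≠ 0 := fun h => h2 (Units.ext (by
      rw [← inv_inv (q : ℂ), eq_neg_of_add_eq_zero_right h]; simp))
    have h3 : T.val 0 1 * T.val 1 0 = 0 := by
      have : (1 - (q : ℂ)⁻¹) * ((1 + (q : ℂ)⁻¹) * (T.val 0 1 * T.val 1 0)) = 0 := by
        linear_combination e3 + (q : ℂ)⁻¹ * e2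
      simpa [h1', h2'] using this
    have h4 : T.val 0 0 * T.val 1 1 = 1 := by linear_combination e2 + (q : ℂ)⁻¹ * h3
    have hx := left_ne_zero_of_mul_eq_one h4
    have hw := right_ne_zero_of_mul_eq_one h4
    have hz : T.val 1 0 = 0 := by simpa [h1', hx] using e1
    have hy : T.val 0 1 = 0 := by simpa [h1', hw] using e4
    refine ⟨Units.mk0 _ hx, (Matrix.eta_fin_two T.val).trans ?_⟩
    rw [hz, hy, eq_inv_of_mul_eq_one_right h4]
    simp
  · rintro ⟨t, ht⟩
    rw [ht]
    simp

theorem mem_congStabilizer_genericForm_neg_one_iff (T : GL (Fin 2) ℂ) :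
    T ∈ congStabilizer (genericForm (-1)) ↔
      (∃ s : ℂˣ, T.val = !![(s : ℂ), 0; 0, (s : ℂ)⁻¹]) ∨
        ∃ t : ℂˣ, T.val = !![0, (t : ℂ); (t : ℂ)⁻¹, 0] := by
  rw [mem_congStabilizer_genericForm]
  have h2 : ((-1 : ℂˣ) : ℂ)⁻¹ = -1 := by norm_num
  have h3 : (1 : ℂ) - -1 ≠ 0 := by norm_num
  rw [h2]
  constructor
  · rintro ⟨⟨e1, e2⟩, -, e4⟩
    replace e1 := (mul_eq_zero.1 e1).resolve_left h3
    replace e4 := (mul_eq_zero.1 e4).resolve_left h3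
    rcases mul_eq_zero.1 e1 with hx | hz
    · right
      have h4 : T.val 0 1 * T.val 1 0 = 1 := by
        rw [hx] at e2; linear_combination e2
      have hy := left_ne_zero_of_mul_eq_one h4
      have hw := (mul_eq_zero.1 e4).resolve_left hy
      refine ⟨Units.mk0 _ hy, (Matrix.eta_fin_two T.val).trans ?_⟩
      rw [hx, hw, eq_inv_of_mul_eq_one_right h4]
      simp
    · left
      have h4 : T.val 0 0 * T.val 1 1 = 1 := by
        rw [hz] at e2; linear_combination e2
      have hx := left_ne_zero_of_mul_eq_one h4
      have hy := (mul_eq_zero.1 e4).resolve_right (right_ne_zero_of_mul_eq_one h4)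
      refine ⟨Units.mk0 _ hx, (Matrix.eta_fin_two T.val).trans ?_⟩
      rw [hz, hy, eq_inv_of_mul_eq_one_right h4]
      simp
  · rintro (⟨t, ht⟩ | ⟨t, ht⟩) <;> rw [ht] <;> simp

theorem mem_congStabilizer_genericForm_one_iff (T : GL (Fin 2) ℂ) :
    T ∈ congStabilizer (genericForm 1) ↔ T.val.det = 1 := by
  rw [mem_congStabilizer_genericForm, Matrix.det_fin_two]
  simp only [Units.val_one, inv_one, sub_self, zero_mul, one_mul, true_and, and_true]
  constructor
  · rintro ⟨e2, -⟩
    linear_combination e2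
  · intro h
    constructor
    · linear_combination h
    · linear_combination -h

theorem mem_congStabilizer_singularForm_iff (T : GL (Fin 2) ℂ) :
    T ∈ congStabilizer singularForm ↔
      ∃ z : ℂ, T.val = !![1, 0; z, 1] ∨ T.val = !![-1, 0; z, -1] := by
  rw [mem_congStabilizer, singularForm, transpose_mul_mul_eq_iff]
  constructor
  · rintro ⟨⟨e1, e2⟩, -, e4⟩
    have hy : T.val 0 1 = 0 := by
      have : T.val 0 1 ^ 2 = 0 := by linear_combination e4
      simpa using this
    have hx : T.val 0 0 = 1 ∨ T.val 0 0 = -1 :=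
      mul_self_eq_one_iff.1 (by linear_combination e1)
    have hw : T.val 0 0 * T.val 1 1 = 1 := by
      rw [hy] at e2; linear_combination e2
    refine ⟨T.val 1 0, hx.imp (fun hx => ?_) fun hx => ?_⟩
    · rw [hx, one_mul] at hw
      rw [Matrix.eta_fin_two T.val, hx, hy, hw]
      simp
    · rw [hx, neg_one_mul] at hw
      rw [Matrix.eta_fin_two T.val, hx, hy, neg_eq_iff_eq_neg.1 hw]
      simp
  · rintro ⟨z, h | h⟩ <;> rw [h] <;> simp

theorem nonempty_congStabilizer_genericForm_mulEquiv {q : ℂˣ} (h1 : q ≠ 1) (h2 : q ≠ -1) :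
    Nonempty (congStabilizer (genericForm q) ≃* ℂˣ) := by
  refine nonempty_mulEquiv_of_injective diagHom diagHom_injective fun T => ?_
  rw [mem_congStabilizer_genericForm_iff h1 h2]
  exact exists_congr fun t => by rw [← diagHom_val, Units.ext_iff, eq_comm]

/-- The permutation matrix of the two basis vectors. -/
noncomputable def swapGL : GL (Fin 2) ℂ :=
  .mkOfDetNeZero !![0, 1; 1, 0] (by simp [Matrix.det_fin_two_of])

theorem swapGL_mul_self : swapGL * swapGL = 1 := by
  ext i j
  fin_cases i <;> fin_cases j <;>
    simp [swapGL, Matrix.GeneralLinearGroup.mkOfDetNeZero, Matrix.mul_apply]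

theorem diagHom_mul_swapGL_val (t : ℂˣ) :
    (diagHom t * swapGL).val = !![0, (t : ℂ); (t : ℂ)⁻¹, 0] := by
  ext i j
  fin_cases i <;> fin_cases j <;>
    simp [swapGL, Matrix.GeneralLinearGroup.mkOfDetNeZero, Matrix.mul_apply, diagHom_val]

theorem swapGL_mul_diagHom (t : ℂˣ) : swapGL * diagHom t * swapGL = diagHom t⁻¹ := by
  refine Units.ext ?_
  rw [mul_assoc, Units.val_mul, diagHom_mul_swapGL_val, diagHom_val]
  ext i j
  fin_cases i <;> fin_cases j <;>
    simp [swapGL, Matrix.GeneralLinearGroup.mkOfDetNeZero, Matrix.mul_apply]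

/-- The group `ℂˣ ⋊ ℤ/2` of monomial matrices which preserve the form `E_{-1}`. -/
noncomputable def monomialHom : ℂˣ ⋊[inversionAction] Multiplicative (ZMod 2) →* GL (Fin 2) ℂ :=
  SemidirectProduct.lift diagHom (involutionHom swapGL swapGL_mul_self) (by
    intro k
    ext1 t
    rcases multiplicative_zmod_two_cases k with rfl | rfl
    · simp
    · have h : swapGL⁻¹ = swapGL := inv_eq_of_mul_eq_one_right swapGL_mul_self
      simp [inversionAction, involutionHom, h, swapGL_mul_diagHom])

theorem nonempty_congStabilizer_genericForm_neg_one_mulEquiv :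
    Nonempty (congStabilizer (genericForm (-1)) ≃*
      ℂˣ ⋊[inversionAction] Multiplicative (ZMod 2)) := by
  have h1 : ∀ t, monomialHom ⟨t, 1⟩ = diagHom t := fun t => by
    simp [monomialHom, SemidirectProduct.lift]
  have h2 : ∀ t, monomialHom ⟨t, Multiplicative.ofAdd 1⟩ = diagHom t * swapGL := fun t => by
    simp [monomialHom, SemidirectProduct.lift, involutionHom]
  refine nonempty_mulEquiv_of_injective monomialHom ?_ fun T => ?_
  · rw [injective_iff_map_eq_one]
    rintro ⟨t, k⟩ h
    rcases multiplicative_zmod_two_cases k with rfl | rfl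
    · rw [h1] at h
      rw [(injective_iff_map_eq_one _).1 diagHom_injective t h]
      rfl
    · rw [h2] at h
      have h3 := congrArg Units.val h
      rw [diagHom_mul_swapGL_val] at h3
      simpa using congrFun (congrFun h3 0) 0
  · rw [mem_congStabilizer_genericForm_neg_one_iff]
    constructor
    · rintro (⟨t, ht⟩ | ⟨t, ht⟩)
      · exact ⟨⟨t, 1⟩, Units.ext ((congrArg Units.val (h1 t)).trans ht.symm)⟩
      · exact ⟨⟨t, Multiplicative.ofAdd 1⟩,
          Units.ext ((congrArg Units.val (h2 t)).trans ((diagHom_mul_swapGL_val t).trans ht.symm))⟩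
    · rintro ⟨⟨t, k⟩, rfl⟩
      rcases multiplicative_zmod_two_cases k with rfl | rfl
      · exact Or.inl ⟨t, congrArg Units.val (h1 t)⟩
      · exact Or.inr ⟨t, (congrArg Units.val (h2 t)).trans (diagHom_mul_swapGL_val t)⟩

theorem nonempty_congStabilizer_genericForm_one_mulEquiv :
    Nonempty (congStabilizer (genericForm 1) ≃* Matrix.SpecialLinearGroup (Fin 2) ℂ) := by
  refine nonempty_mulEquiv_of_injective Matrix.SpecialLinearGroup.toGL
    Matrix.SpecialLinearGroup.toGL_injective fun T => ?_
  rw [mem_congStabilizer_genericForm_one_iff]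
  constructor
  · intro h
    exact ⟨⟨T.val, h⟩, Units.ext rfl⟩
  · rintro ⟨S, rfl⟩
    exact S.2

/-- The unipotent matrices with entry `z` below the diagonal. -/
noncomputable def unipotentHom : Multiplicative ℂ →* GL (Fin 2) ℂ where
  toFun z := .mkOfDetNeZero !![1, 0; z.toAdd, 1] (by simp [Matrix.det_fin_two_of])
  map_one' := by
    ext i j; fin_cases i <;> fin_cases j <;> simp [Matrix.GeneralLinearGroup.mkOfDetNeZero]
  map_mul' s t := by
    ext i j
    fin_cases i <;> fin_cases j <;>
      simp [Matrix.GeneralLinearGroup.mkOfDetNeZero, Matrix.mul_apply]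

theorem unipotentHom_val (z : Multiplicative ℂ) :
    (unipotentHom z).val = !![1, 0; z.toAdd, 1] := rfl

theorem unipotentHom_mul_neg_one_val (z : Multiplicative ℂ) :
    (unipotentHom z * -1).val = !![-1, 0; -z.toAdd, -1] := by
  ext i j
  fin_cases i <;> fin_cases j <;> simp [unipotentHom_val]

/-- The group `ℂ × ℤ/2` of unipotent matrices up to sign. -/
noncomputable def signedUnipotentHom :
    Multiplicative ℂ ⋊[(1 : Multiplicative (ZMod 2) →* MulAut (Multiplicative ℂ))]
      Multiplicative (ZMod 2) →* GL (Fin 2) ℂ :=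
  SemidirectProduct.lift unipotentHom (involutionHom (-1) (by simp)) (by
    intro k
    refine MonoidHom.ext fun t => ?_
    rcases multiplicative_zmod_two_cases k with rfl | rfl
    · simp
    · simp [involutionHom])

theorem nonempty_congStabilizer_singularForm_mulEquiv :
    Nonempty (congStabilizer singularForm ≃*
      Multiplicative ℂ ⋊[(1 : Multiplicative (ZMod 2) →* MulAut (Multiplicative ℂ))]
        Multiplicative (ZMod 2)) := by
  have h1 : ∀ t, signedUnipotentHom ⟨t, 1⟩ = unipotentHom t := fun t => by
    simp [signedUnipotentHom, SemidirectProduct.lift]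
  have h2 : ∀ t, signedUnipotentHom ⟨t, Multiplicative.ofAdd 1⟩ = unipotentHom t * -1 :=
    fun t => by
      simp [signedUnipotentHom, SemidirectProduct.lift, involutionHom]
  refine nonempty_mulEquiv_of_injective signedUnipotentHom ?_ fun T => ?_
  · rw [injective_iff_map_eq_one]
    rintro ⟨t, k⟩ h
    rcases multiplicative_zmod_two_cases k with rfl | rfl
    · rw [h1] at h
      have := congrArg (fun T : GL (Fin 2) ℂ => T.val 1 0) h
      obtain rfl : t = 1 := by simpa [unipotentHom_val] using this
      rfl
    · rw [h2] at h
      have h3 := congrArg Units.val h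
      rw [unipotentHom_mul_neg_one_val] at h3
      have h4 := congrFun (congrFun h3 0) 0
      norm_num at h4
  · rw [mem_congStabilizer_singularForm_iff]
    constructor
    · rintro ⟨z, hz | hz⟩
      · exact ⟨⟨.ofAdd z, 1⟩, Units.ext ((congrArg Units.val (h1 _)).trans hz.symm)⟩
      · refine ⟨⟨.ofAdd (-z), Multiplicative.ofAdd 1⟩, Units.ext ?_⟩
        rw [h2, unipotentHom_mul_neg_one_val, hz]
        simp
    · rintro ⟨⟨t, k⟩, rfl⟩
      rcases multiplicative_zmod_two_cases k with rfl | rfl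
      · exact ⟨t.toAdd, Or.inl (congrArg Units.val (h1 t))⟩
      · exact ⟨-t.toAdd, Or.inr
          ((congrArg Units.val (h2 t)).trans (unipotentHom_mul_neg_one_val t))⟩

/-! ### Words and the matrices of planar tangles -/

/-- Words of length `n` in the two letters `0, 1`.  They index the standard basis of the `n`-th
tensor power of a two-dimensional space. -/
abbrev Word (n : ℕ) : Type := Fin n → Fin 2

namespace Word

/-- The first `m` letters of a word of length `m + n`. -/
def left {m n : ℕ} (u : Word (m + n)) : Word m := fun i => u (Fin.castAdd n i)

/-- The last `n` letters of a word of length `m + n`. -/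
def right {m n : ℕ} (u : Word (m + n)) : Word n := fun i => u (Fin.natAdd m i)

/-- Transport of a word along an equality of lengths. -/
def cast {m n : ℕ} (h : m = n) (u : Word n) : Word m := fun i => u (Fin.cast h i)

@[simp] theorem left_append {m n : ℕ} (u : Word m) (v : Word n) :
    left (Fin.append u v) = u := by
  funext i; simp [left]

@[simp] theorem right_append {m n : ℕ} (u : Word m) (v : Word n) :
    right (Fin.append u v) = v := by
  funext i; simp [right]

@[simp] theorem append_left_right {m n : ℕ} (u : Word (m + n)) :
    Fin.append (left u) (right u) = u :=
  Fin.append_castAdd_natAdd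

@[simp] theorem cast_rfl {n : ℕ} (u : Word n) : cast rfl u = u := rfl

theorem exists_eq_append {m n : ℕ} (w : Word (m + n)) :
    ∃ (u : Word m) (v : Word n), w = Fin.append u v :=
  ⟨_, _, (append_left_right w).symm⟩

theorem ext_iff_left_right {m n : ℕ} {u v : Word (m + n)} :
    u = v ↔ left u = left v ∧ right u = right v := by
  constructor
  · rintro rfl; exact ⟨rfl, rfl⟩
  · rintro ⟨h, h'⟩; rw [← append_left_right u, h, h', append_left_right]

theorem sum_add {M : Type*} [AddCommMonoid M] {m n : ℕ} (f : Word (m + n) → M) :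
    ∑ w, f w = ∑ u : Word m, ∑ v : Word n, f (Fin.append u v) := by
  rw [← (Fin.appendEquiv m n).sum_comp, Fintype.sum_prod_type]
  rfl

theorem sum_one {M : Type*} [AddCommMonoid M] (f : Word 1 → M) :
    ∑ w, f w = ∑ i, f (fun _ => i) :=
  ((Equiv.funUnique (Fin 1) (Fin 2)).symm.sum_comp f).symm

theorem sum_zero {M : Type*} [AddCommMonoid M] (f : Word 0 → M) :
    ∑ w, f w = f Fin.elim0 := by
  rw [Fintype.sum_unique]
  exact congrArg f (Subsingleton.elim _ _)

theorem append_const_zero (i j : Fin 2) :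
    Fin.append (fun _ : Fin 1 => i) (fun _ : Fin 1 => j) 0 = i := rfl

theorem append_const_one (i j : Fin 2) :
    Fin.append (fun _ : Fin 1 => i) (fun _ : Fin 1 => j) 1 = j := rfl

end Word

/-- The matrix, in the bases indexed by words, of the linear map which an expression becomes when
the arcs `cap` and `cup` are interpreted by the tensors `E` and `D`.  Rows are indexed by the
source, so that stacking becomes multiplication in the same order. -/
noncomputable def interp (E D : Matrix (Fin 2) (Fin 2) ℂ) :
    ∀ {m n : ℕ}, TLExpr m n → Matrix (Word m) (Word n) ℂ
  | _, _, .ident h => Matrix.of fun u v => if u = Word.cast h v then 1 else 0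
  | _, _, .comp f g => interp E D f * interp E D g
  | _, _, .tensor f g => Matrix.of fun u v =>
      interp E D f u.left v.left * interp E D g u.right v.right
  | _, _, .cap => Matrix.of fun u _ => E (u 0) (u 1)
  | _, _, .cup => Matrix.of fun _ v => D (v 0) (v 1)
  | _, _, .zero => 0
  | _, _, .add f g => interp E D f + interp E D g
  | _, _, .smul c f => c • interp E D f

section Interp

variable {E D : Matrix (Fin 2) (Fin 2) ℂ}

theorem interp_ident_apply {m n : ℕ} (h : m = n) (u : Word m) (v : Word n) :
    interp E D (.ident h) u v = if u = Word.cast h v then 1 else 0 := rfl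

theorem interp_comp_apply {l m n : ℕ} (f : TLExpr l m) (g : TLExpr m n) (u : Word l)
    (w : Word n) : interp E D (f.comp g) u w = ∑ v, interp E D f u v * interp E D g v w := rfl

theorem interp_tensor_apply {m n m' n' : ℕ} (f : TLExpr m n) (g : TLExpr m' n')
    (u : Word (m + m')) (v : Word (n + n')) : interp E D (f.tensor g) u v =
      interp E D f u.left v.left * interp E D g u.right v.right := rfl

theorem interp_cap_apply (u : Word (1 + 1)) (v : Word 0) :
    interp E D .cap u v = E (u 0) (u 1) := rfl

theorem interp_cup_apply (u : Word 0) (v : Word (1 + 1)) :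
    interp E D .cup u v = D (v 0) (v 1) := rfl

theorem interp_ident_rfl (n : ℕ) : interp E D (.ident (rfl : n = n)) = 1 := by
  ext u v
  rw [interp, Matrix.of_apply, Matrix.one_apply, Word.cast_rfl]

theorem interp_ident_mul {l m n : ℕ} (h : l = m) (M : Matrix (Word m) (Word n) ℂ) (u : Word l)
    (v : Word n) : (interp E D (.ident h) * M) u v = M (Word.cast h.symm u) v := by
  subst h; simp [interp_ident_rfl]

theorem interp_ident_comp_apply {l m n : ℕ} (h : l = m) (f : TLExpr m n) (u : Word l)
    (v : Word n) : interp E D ((TLExpr.ident h).comp f) u v = interp E D f (Word.cast h.symm u) v :=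
  interp_ident_mul h _ u v

theorem mul_interp_ident {l m n : ℕ} (h : m = n) (M : Matrix (Word l) (Word m) ℂ) (u : Word l)
    (v : Word n) : (M * interp E D (.ident h)) u v = M u (Word.cast h v) := by
  subst h; simp [interp_ident_rfl]

theorem interp_zigzag_left (i j : Fin 2) :
    interp E D (((TLExpr.ident (rfl : 1 = 1)).tensor TLExpr.cup).comp
      ((TLExpr.ident (Nat.add_assoc 1 1 1).symm).comp
        (TLExpr.cap.tensor (TLExpr.ident (rfl : 1 = 1))))) (fun _ => i) (fun _ => j) =
      (E * D) i j := by
  have e0 : ∀ i j k : Fin 2, Fin.append (fun _ : Fin 1 => i)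
      (Fin.append (fun _ : Fin 1 => j) (fun _ : Fin 1 => k)) 0 = i := fun _ _ _ => rfl
  have e1 : ∀ i j k : Fin 2, Fin.append (fun _ : Fin 1 => i)
      (Fin.append (fun _ : Fin 1 => j) (fun _ : Fin 1 => k)) 1 = j := fun _ _ _ => rfl
  have e2 : ∀ i j k : Fin 2, Fin.append (fun _ : Fin 1 => i)
      (Fin.append (fun _ : Fin 1 => j) (fun _ : Fin 1 => k)) 2 = k := fun _ _ _ => rfl
  rw [interp_comp_apply, Word.sum_add]
  simp only [interp_ident_comp_apply, interp_tensor_apply, Word.sum_add, Word.sum_one,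
    Word.left_append, Word.right_append, interp_cap_apply, interp_cup_apply,
    Word.append_const_zero, Word.append_const_one, interp_ident_apply, Word.cast_rfl]
  fin_cases i <;> fin_cases j <;>
    simp [Word.left, Word.right, Matrix.mul_apply, funext_iff, e0, e1, e2] <;>
    ring

theorem interp_zigzag_right (i j : Fin 2) :
    interp E D ((TLExpr.cup.tensor (TLExpr.ident (rfl : 1 = 1))).comp
      ((TLExpr.ident (Nat.add_assoc 1 1 1)).comp
        ((TLExpr.ident (rfl : 1 = 1)).tensor TLExpr.cap))) (fun _ => i) (fun _ => j) =
      (D * E) j i := by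
  have e0 : ∀ i j k : Fin 2, Fin.append (Fin.append (fun _ : Fin 1 => i)
      (fun _ : Fin 1 => j)) (fun _ : Fin 1 => k) 0 = i := fun _ _ _ => rfl
  have e1 : ∀ i j k : Fin 2, Fin.append (Fin.append (fun _ : Fin 1 => i)
      (fun _ : Fin 1 => j)) (fun _ : Fin 1 => k) 1 = j := fun _ _ _ => rfl
  have e2 : ∀ i j k : Fin 2, Fin.append (Fin.append (fun _ : Fin 1 => i)
      (fun _ : Fin 1 => j)) (fun _ : Fin 1 => k) 2 = k := fun _ _ _ => rfl
  rw [interp_comp_apply, Word.sum_add]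
  simp only [interp_ident_comp_apply, interp_tensor_apply, Word.sum_add, Word.sum_one,
    Word.left_append, Word.right_append, interp_cap_apply, interp_cup_apply,
    Word.append_const_zero, Word.append_const_one, interp_ident_apply, Word.cast_rfl]
  fin_cases i <;> fin_cases j <;>
    simp [Word.left, Word.right, Matrix.mul_apply, funext_iff, e0, e1, e2]

theorem interp_loop (u v : Word 0) :
    interp E D (TLExpr.cup.comp TLExpr.cap) u v = ∑ i, ∑ j, D i j * E i j := by
  rw [interp_comp_apply, Word.sum_add]
  simp only [interp_cap_apply, interp_cup_apply, Word.sum_one, Word.append_const_zero,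
    Word.append_const_one]

/-- The matrices satisfy the relations of the Temperley-Lieb category as soon as `D` is the inverse
of `E` (straightening of bent strings) and `∑ D_ij E_ij = d` (value of a loop). -/
theorem interp_eq_of_rel {d : ℂ} (hED : E * D = 1) (hDE : D * E = 1)
    (hd : ∑ i, ∑ j, D i j * E i j = d) {m n : ℕ} {f g : TLExpr m n} (h : TLRel d f g) :
    interp E D f = interp E D g := by
  induction h with
  | refl f => rfl
  | symm _ ih => exact ih.symm
  | trans _ _ ih ih' => exact ih.trans ih'
  | congr_comp _ _ ih ih' => simp only [interp, ih, ih']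
  | congr_tensor _ _ ih ih' => simp only [interp, ih, ih']
  | congr_add _ _ ih ih' => simp only [interp, ih, ih']
  | congr_smul c _ ih => simp only [interp, ih]
  | id_comp f => rw [interp, interp_ident_rfl, Matrix.one_mul]
  | comp_id f => rw [interp, interp_ident_rfl, Matrix.mul_one]
  | assoc f g h => simp only [interp, Matrix.mul_assoc]
  | add_assoc f g h => simp only [interp, add_assoc]
  | add_comm f g => simp only [interp, add_comm]
  | zero_add f => simp only [interp, zero_add]
  | neg_add f => simp [interp]
  | smul_add c f g => simp only [interp, smul_add]
  | add_smul c c' f => simp only [interp, add_smul]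
  | mul_smul c c' f => simp only [interp, mul_smul]
  | one_smul f => simp only [interp, one_smul]
  | add_comp f f' g => simp only [interp, Matrix.add_mul]
  | comp_add f g g' => simp only [interp, Matrix.mul_add]
  | smul_comp c f g => simp only [interp, Matrix.smul_mul]
  | comp_smul c f g => simp only [interp, Matrix.mul_smul]
  | add_tensor f f' g =>
    ext u v; simp only [interp, Matrix.add_apply, Matrix.of_apply, add_mul]
  | tensor_add f g g' =>
    ext u v; simp only [interp, Matrix.add_apply, Matrix.of_apply, mul_add]
  | smul_tensor c f g =>
    ext u v; simp only [interp, Matrix.smul_apply, Matrix.of_apply, smul_eq_mul, mul_assoc]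
  | tensor_smul c f g =>
    ext u v; simp only [interp, Matrix.smul_apply, Matrix.of_apply, smul_eq_mul, mul_left_comm]
  | tensor_id m n =>
    ext u v
    simp only [interp_tensor_apply, interp_ident_rfl, Matrix.one_apply,
      Word.ext_iff_left_right (u := u), ite_and]
    split_ifs <;> simp
  | interchange f g f' g' =>
    ext u v
    simp only [interp, Matrix.mul_apply, Matrix.of_apply, Word.sum_add, Word.left_append,
      Word.right_append, Finset.sum_mul_sum]
    exact Finset.sum_congr rfl fun _ _ => Finset.sum_congr rfl fun _ _ => by ring
  | tensor_assoc f g h =>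
    ext u v
    rw [interp, mul_interp_ident, interp, interp_ident_mul]
    simp only [interp, Matrix.of_apply, mul_assoc]
    congr 2
    congr 1 <;> funext i <;> simp only [Word.right, Word.cast] <;> congr 1 <;>
      simp only [Fin.ext_iff, Fin.val_natAdd, Fin.val_cast] <;> omega
  | unit_tensor f =>
    ext u v
    rw [interp, mul_interp_ident, interp, interp_ident_mul]
    simp only [interp, Matrix.of_apply]
    rw [if_pos (Subsingleton.elim _ _), one_mul]
    congr 1 <;> funext i <;> simp only [Word.right, Word.cast] <;> congr 1 <;>
      simp only [Fin.ext_iff, Fin.val_natAdd, Fin.val_cast] <;> omega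
  | tensor_unit f =>
    ext u v
    rw [interp, mul_interp_ident, interp, interp_ident_mul]
    simp only [interp, Matrix.of_apply]
    rw [if_pos (Subsingleton.elim _ _), mul_one]
    congr 1
  | zigzag_left =>
    ext u v
    obtain ⟨i, rfl⟩ := (Equiv.funUnique (Fin 1) (Fin 2)).symm.surjective u
    obtain ⟨j, rfl⟩ := (Equiv.funUnique (Fin 1) (Fin 2)).symm.surjective v
    refine (interp_zigzag_left i j).trans ?_
    rw [hED, Matrix.one_apply]
    exact (if_congr (funext_iff.trans (by simp [Word.cast])) rfl rfl).symm
  | zigzag_right =>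
    ext u v
    obtain ⟨i, rfl⟩ := (Equiv.funUnique (Fin 1) (Fin 2)).symm.surjective u
    obtain ⟨j, rfl⟩ := (Equiv.funUnique (Fin 1) (Fin 2)).symm.surjective v
    refine (interp_zigzag_right i j).trans ?_
    rw [hDE, Matrix.one_apply]
    exact (if_congr (funext_iff.trans (by simp [Word.cast, eq_comm])) rfl rfl).symm
  | loop =>
    ext u v
    rw [interp_loop, hd]
    simp [interp, Subsingleton.elim u v]

end Interp

/-! ### The fiber functor of a nondegenerate form -/

/-- The matrix of a morphism of the Temperley-Lieb category. -/
noncomputable def interpHom {d : ℂ} {E D : Matrix (Fin 2) (Fin 2) ℂ} (hED : E * D = 1)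
    (hDE : D * E = 1) (hd : ∑ i, ∑ j, D i j * E i j = d) {m n : ℕ} (f : TL.HomTL d m n) :
    Matrix (Word m) (Word n) ℂ :=
  Quotient.lift (interp E D) (fun _ _ h => interp_eq_of_rel hED hDE hd h) f

/-- Concatenation of words, as an isomorphism from the tensor product of two spaces of functions
on words. -/
noncomputable def wordMul (m n : ℕ) :
    (Word m → ℂ) ⊗[ℂ] (Word n → ℂ) ≃ₗ[ℂ] (Word (m + n) → ℂ) :=
  (((Pi.basisFun ℂ (Word m)).tensorProduct (Pi.basisFun ℂ (Word n))).reindex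
    (Fin.appendEquiv m n)).equivFun

theorem wordMul_tmul (m n : ℕ) (x : Word m → ℂ) (y : Word n → ℂ) (w : Word (m + n)) :
    wordMul m n (x ⊗ₜ y) w = x w.left * y w.right := by
  rw [wordMul, Module.Basis.equivFun_apply, Module.Basis.repr_reindex_apply,
    Module.Basis.tensorProduct_repr_tmul_apply, smul_eq_mul, mul_comm]
  rfl

theorem vecMul_interp_ident {E D : Matrix (Fin 2) (Fin 2) ℂ} {m n : ℕ} (h : m = n)
    (x : Word m → ℂ) (w : Word n) :
    Matrix.vecMul x (interp E D (.ident h)) w = x (Word.cast h w) := by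
  subst h; rw [interp_ident_rfl, Matrix.vecMul_one, Word.cast_rfl]

/-- Juxtaposition of tangles corresponds to the tensor product of linear maps. -/
theorem vecMul_wordMul_interp_tensor {E D : Matrix (Fin 2) (Fin 2) ℂ} {m n m' n' : ℕ}
    (f : TLExpr m n) (g : TLExpr m' n') (x : Word m → ℂ) (y : Word m' → ℂ) :
    Matrix.vecMul (wordMul m m' (x ⊗ₜ y)) (interp E D (f.tensor g)) =
      wordMul n n' (Matrix.vecMul x (interp E D f) ⊗ₜ Matrix.vecMul y (interp E D g)) := by
  ext w
  simp only [wordMul_tmul, Matrix.vecMul, dotProduct, Word.sum_add, interp_tensor_apply,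
    Word.left_append, Word.right_append, Finset.sum_mul_sum]
  exact Finset.sum_congr rfl fun _ _ => Finset.sum_congr rfl fun _ _ => by ring

/-- The empty word identifies scalars with functions on words of length zero. -/
noncomputable def wordOne : ℂ ≃ₗ[ℂ] (Word 0 → ℂ) := (LinearEquiv.funUnique (Word 0) ℂ ℂ).symm

section

variable {d : ℂ} {E D : Matrix (Fin 2) (Fin 2) ℂ} (hED : E * D = 1)
  (hDE : D * E = 1) (hd : ∑ i, ∑ j, D i j * E i j = d)

/-- The functor `n ↦ V^{⊗ n}` for `V = ℂ²`, where `V^{⊗ n}` is modelled by functions on words and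
the arcs are sent to `E` and its inverse `D`. -/
noncomputable def stdFunctor : TL d ⥤ FGModuleCat.{0} ℂ where
  obj A := FGModuleCat.of ℂ (Word A.n → ℂ)
  map {A B} f := FGModuleCat.ofHom (Matrix.vecMulLinear (interpHom hED hDE hd f))
  map_id A := by
    apply FGModuleCat.hom_ext
    refine LinearMap.ext fun x : Word A.n → ℂ => ?_
    change Matrix.vecMul x (interp E D (.ident rfl)) = x
    rw [interp_ident_rfl, Matrix.vecMul_one]
  map_comp := by
    rintro A B C ⟨f⟩ ⟨g⟩
    apply FGModuleCat.hom_ext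
    refine LinearMap.ext fun x : Word A.n → ℂ => ?_
    change Matrix.vecMul x (interp E D f * interp E D g) = _
    rw [← Matrix.vecMul_vecMul]
    rfl

instance : (stdFunctor hED hDE hd).Additive where
  map_add := by
    rintro A B ⟨f⟩ ⟨g⟩
    ext x
    exact Matrix.vecMul_add (interp E D f) (interp E D g) x

instance : (stdFunctor hED hDE hd).Linear ℂ where
  map_smul := by
    rintro A B ⟨f⟩ c
    ext x
    exact Matrix.vecMul_smul x c (interp E D f)

/-- The monoidal structure of `stdFunctor`: concatenation of words. -/
noncomputable def stdCore : (stdFunctor hED hDE hd).CoreMonoidal where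
  εIso := LinearEquiv.toFGModuleCatIso wordOne
  μIso A B := LinearEquiv.toFGModuleCatIso (wordMul A.n B.n)
  μIso_hom_natural_left := by
    rintro A B ⟨f⟩ C
    apply FGModuleCat.hom_ext
    apply TensorProduct.ext'
    intro (x : Word A.n → ℂ) (y : Word C.n → ℂ)
    refine Eq.trans ?_ (vecMul_wordMul_interp_tensor f (.ident rfl) x y).symm
    rw [interp_ident_rfl, Matrix.vecMul_one]
    rfl
  μIso_hom_natural_right := by
    rintro A B C ⟨f⟩
    apply FGModuleCat.hom_ext
    apply TensorProduct.ext'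
    intro (x : Word C.n → ℂ) (y : Word A.n → ℂ)
    refine Eq.trans ?_ (vecMul_wordMul_interp_tensor (.ident rfl) f x y).symm
    rw [interp_ident_rfl, Matrix.vecMul_one]
    rfl
  associativity A B C := by
    apply FGModuleCat.hom_ext
    apply TensorProduct.ext_threefold
    intro (x : Word A.n → ℂ) (y : Word B.n → ℂ) (z : Word C.n → ℂ)
    change Matrix.vecMul (wordMul _ _ (wordMul _ _ (x ⊗ₜ y) ⊗ₜ z)) (interp E D (.ident _)) =
      wordMul _ _ (x ⊗ₜ wordMul _ _ (y ⊗ₜ z))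
    refine funext fun w : Word (A.n + (B.n + C.n)) => ?_
    erw [vecMul_interp_ident, wordMul_tmul, wordMul_tmul, wordMul_tmul, wordMul_tmul]
    rw [mul_assoc]
    congr 2
    refine congrArg z (funext fun i => ?_)
    simp only [Word.right, Word.cast]
    congr 1
    simp only [Fin.ext_iff, Fin.val_natAdd, Fin.val_cast]
    exact Nat.add_assoc _ _ _
  left_unitality A := by
    apply FGModuleCat.hom_ext
    apply TensorProduct.ext'
    intro (c : ℂ) (x : Word A.n → ℂ)
    change c • x =
      Matrix.vecMul (wordMul _ _ (wordOne c ⊗ₜ x)) (interp E D (.ident (Nat.zero_add _)))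
    refine funext fun w : Word A.n => ?_
    rw [vecMul_interp_ident, wordMul_tmul, Pi.smul_apply]
    refine congrArg (c * ·) (congrArg x (funext fun i => congrArg w (Fin.ext ?_)))
    simp
  right_unitality A := by
    apply FGModuleCat.hom_ext
    apply TensorProduct.ext'
    intro (x : Word A.n → ℂ) (c : ℂ)
    change c • x =
      Matrix.vecMul (wordMul _ _ (x ⊗ₜ wordOne c)) (interp E D (.ident (Nat.add_zero _)))
    refine funext fun w : Word A.n => ?_
    rw [vecMul_interp_ident, wordMul_tmul, Pi.smul_apply]
    exact mul_comm _ _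

/-- The fiber functor `n ↦ V^{⊗ n}` with the form `E` on `V = ℂ²`. -/
noncomputable def stdFiberFunctor : FiberFunctor d where
  functor := stdFunctor hED hDE hd
  additive := inferInstance
  linear := inferInstance
  monoidal := (stdCore hED hDE hd).toMonoidal

theorem stdFiberFunctor_hasForm : (stdFiberFunctor hED hDE hd).HasForm E := by
  let b : Module.Basis (Fin 2) ℂ (Word 1 → ℂ) :=
    (Pi.basisFun ℂ (Word 1)).reindex (Equiv.funUnique (Fin 1) (Fin 2))
  refine ⟨b, fun i j => ?_⟩
  change wordOne.symm (Matrix.vecMul (wordMul 1 1 (b i ⊗ₜ b j)) (interp E D .cap)) = E i j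
  change ∑ w : Word (1 + 1), wordMul 1 1 (b i ⊗ₜ b j) w * E (w 0) (w 1) = E i j
  simp only [Word.sum_add, Word.sum_one, wordMul_tmul, Word.left_append, Word.right_append,
    Word.append_const_zero, Word.append_const_one]
  have hb : ∀ i k, b i (fun _ => k) = if k = i then 1 else 0 := by
    intro i k
    simp [b, Pi.single_apply, funext_iff]
  simp [hb]

theorem stdFiberFunctor_dim : (stdFiberFunctor hED hDE hd).dim = 2 := by
  change Module.finrank ℂ (Word 1 → ℂ) = 2
  simp

end

/-! ### The word basis of a fiber functor -/

namespace FiberFunctor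

variable {d : ℂ} (F : FiberFunctor d)

/-- The multiplicativity isomorphism as a linear equivalence. -/
noncomputable def muEquiv (A B : TL d) :
    (F.space A ⊗[ℂ] F.space B) ≃ₗ[ℂ] F.space (A ⊗ B) :=
  FGModuleCat.isoToLinearEquiv (Functor.Monoidal.μIso F.functor A B)

theorem muEquiv_apply (A B : TL d) (x : F.space A ⊗[ℂ] F.space B) :
    F.muEquiv A B x = F.mu A B x := rfl

/-- The unit isomorphism as a linear equivalence. -/
noncomputable def unitEquiv : ℂ ≃ₗ[ℂ] F.space (𝟙_ (TL d)) :=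
  FGModuleCat.isoToLinearEquiv (Functor.Monoidal.εIso F.functor)

theorem unitEquiv_apply (c : ℂ) : F.unitEquiv c = F.unit c := rfl

theorem map_comp_apply {A B C : TL d} (f : A ⟶ B) (g : B ⟶ C) (x : F.space A) :
    F.map (f ≫ g) x = F.map g (F.map f x) := by
  simp only [map, Functor.map_comp]; rfl

theorem map_id_apply {A : TL d} (x : F.space A) : F.map (𝟙 A) x = x := by
  exact congrArg (fun φ => φ.hom.hom x) (F.functor.map_id A)

theorem map_add {A B : TL d} (f g : A ⟶ B) : F.map (f + g) = F.map f + F.map g := by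
  simp only [map, Functor.map_add]; rfl

theorem map_smul {A B : TL d} (c : ℂ) (f : A ⟶ B) : F.map (c • f) = c • F.map f := by
  simp only [map, Functor.map_smul]; rfl

theorem map_zero {A B : TL d} : F.map (0 : A ⟶ B) = 0 := by
  simp only [map, Functor.map_zero]; rfl

theorem map_tensorHom_mu {A B A' B' : TL d} (f : A ⟶ B) (g : A' ⟶ B') (x : F.space A)
    (y : F.space A') :
    F.map (f ⊗ₘ g) (F.mu A A' (x ⊗ₜ y)) = F.mu B B' (F.map f x ⊗ₜ F.map g y) := by
  have h := Functor.LaxMonoidal.μ_natural F.functor f g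
  exact (congrArg (fun φ => φ.hom.hom (x ⊗ₜ[ℂ] y)) h).symm

theorem map_associator_mu (A B C : TL d) (x : F.space A) (y : F.space B) (z : F.space C) :
    F.map (α_ A B C).hom (F.mu (A ⊗ B) C (F.mu A B (x ⊗ₜ y) ⊗ₜ z)) =
      F.mu A (B ⊗ C) (x ⊗ₜ F.mu B C (y ⊗ₜ z)) := by
  have h := Functor.LaxMonoidal.associativity F.functor A B C
  exact (congrArg (fun φ => φ.hom.hom ((x ⊗ₜ[ℂ] y) ⊗ₜ[ℂ] z)) h)

theorem map_rightUnitor_mu (A : TL d) (x : F.space A) :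
    F.map (ρ_ A).hom (F.mu A (𝟙_ _) (x ⊗ₜ F.unit 1)) = x := by
  have h := Functor.LaxMonoidal.right_unitality F.functor A
  have h' := (congrArg (fun φ => φ.hom.hom (x ⊗ₜ[ℂ] (1 : ℂ))) h)
  refine Eq.trans h'.symm ?_
  exact (TensorProduct.rid_tmul x (1 : ℂ)).trans (one_smul _ _)

variable (b : Module.Basis (Fin 2) ℂ (F.space TL.X))

/-- The basis of `F(X^{⊗ n})` consisting of the products of elements of a basis of `F(X)`. -/
noncomputable def wordBasis : ∀ n : ℕ, Module.Basis (Word n) ℂ (F.space ⟨n⟩)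
  | 0 => (Module.Basis.singleton (Word 0) ℂ).map F.unitEquiv
  | n + 1 => (((wordBasis n).tensorProduct b).map (F.muEquiv ⟨n⟩ TL.X)).reindex
      (Fin.succFunEquiv (Fin 2) n).symm

theorem wordBasis_zero (u : Word 0) : F.wordBasis b 0 u = F.unit 1 := by
  rw [wordBasis, Module.Basis.map_apply, Module.Basis.singleton_apply]
  rfl

theorem wordBasis_succ (n : ℕ) (u : Word (n + 1)) : F.wordBasis b (n + 1) u =
    F.mu ⟨n⟩ TL.X (F.wordBasis b n (fun i => u i.castSucc) ⊗ₜ b (u (Fin.last n))) := by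
  refine ((((F.wordBasis b n).tensorProduct b).map (F.muEquiv ⟨n⟩ TL.X)).reindex_apply
    (Fin.succFunEquiv (Fin 2) n).symm u).trans ?_
  rw [Module.Basis.map_apply, Module.Basis.tensorProduct_apply', muEquiv_apply]
  rfl

theorem mu_wordBasis {m n : ℕ} (u : Word m) (v : Word n) :
    F.mu ⟨m⟩ ⟨n⟩ (F.wordBasis b m u ⊗ₜ F.wordBasis b n v) =
      F.wordBasis b (m + n) (Fin.append u v) := by
  induction n with
  | zero =>
    rw [wordBasis_zero]
    refine Eq.trans ?_ ((F.map_rightUnitor_mu ⟨m⟩ (F.wordBasis b m u)).trans ?_)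
    · exact (F.map_id_apply _).symm
    · refine congrArg (F.wordBasis b m) (funext fun i => ?_)
      exact (Fin.append_left u v i).symm
  | succ n ih =>
    rw [wordBasis_succ]
    refine (F.map_associator_mu ⟨m⟩ ⟨n⟩ TL.X _ _ _).symm.trans ?_
    rw [ih]
    refine Eq.trans (F.map_id_apply _) ?_
    have h : F.wordBasis b (m + n + 1) (Fin.append u v : Word (m + (n + 1))) = _ :=
      F.wordBasis_succ b (m + n) (Fin.append u v : Word (m + (n + 1)))
    refine Eq.trans ?_ h.symm
    have h1 : Fin.append u (fun i => v i.castSucc) =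
        fun i : Fin (m + n) => (Fin.append u v : Word (m + (n + 1))) i.castSucc := by
      funext i
      induction i using Fin.addCases with
      | left i => rw [Fin.append_left]; exact (Fin.append_left u v i).symm
      | right i => rw [Fin.append_right]; exact (Fin.append_right u v i.castSucc).symm
    have h2 : v (Fin.last n) = (Fin.append u v : Word (m + (n + 1))) (Fin.last (m + n)) :=
      (Fin.append_right u v (Fin.last n)).symm
    rw [h1, h2]
    rfl

theorem map_leftUnitor_mu (A : TL d) (x : F.space A) :
    F.map (λ_ A).hom (F.mu (𝟙_ _) A (F.unit 1 ⊗ₜ x)) = x := by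
  have h := Functor.LaxMonoidal.left_unitality F.functor A
  have h' := (congrArg (fun φ => φ.hom.hom ((1 : ℂ) ⊗ₜ[ℂ] x)) h)
  refine Eq.trans h'.symm ?_
  exact (TensorProduct.lid_tmul x (1 : ℂ)).trans (one_smul _ _)

theorem wordBasis_one (u : Word 1) : F.wordBasis b 1 u = b (u 0) := by
  have h : F.wordBasis b 1 u = F.mu ⟨0⟩ TL.X (F.unit 1 ⊗ₜ b (u 0)) :=
    (F.wordBasis_succ b 0 u).trans (by rw [wordBasis_zero]; rfl)
  rw [h]
  refine Eq.trans ?_ (F.map_leftUnitor_mu TL.X (b (u 0)))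
  exact (F.map_id_apply _).symm

theorem map_arc_mu (x y : F.space TL.X) :
    F.map TL.arc (F.mu TL.X TL.X (x ⊗ₜ y)) = F.unit (F.form (x ⊗ₜ y)) :=
  (F.unitEquiv.apply_symm_apply _).symm

/-- The matrix of the bilinear form in a basis. -/
noncomputable def formMatrix : Matrix (Fin 2) (Fin 2) ℂ :=
  Matrix.of fun i j => F.form (b i ⊗ₜ b j)

/-- The coordinates of the image of the arc `I → X ⊗ X`. -/
noncomputable def cupMatrix : Matrix (Fin 2) (Fin 2) ℂ :=
  Matrix.of fun i j => (F.wordBasis b (1 + 1)).repr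
    (F.map (TL.cls TLExpr.cup : (⟨0⟩ : TL d) ⟶ ⟨1 + 1⟩) (F.unit 1))
      (Fin.append (fun _ => i) (fun _ => j))

/-- A fiber functor is determined by its matrices: on word bases it acts on every tangle by the
matrix of the tangle. -/
theorem map_wordBasis {m n : ℕ} (f : TLExpr m n) (u : Word m) :
    F.map (TL.cls f : (⟨m⟩ : TL d) ⟶ ⟨n⟩) (F.wordBasis b m u) =
      ∑ v, interp (F.formMatrix b) (F.cupMatrix b) f u v • F.wordBasis b n v := by
  induction f with
  | ident h =>
    subst h
    refine (F.map_id_apply _).trans ?_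
    simp [interp_ident_rfl, Matrix.one_apply]
  | comp f g ihf ihg =>
    refine (F.map_comp_apply (TL.cls f) (TL.cls g) _).trans ?_
    rw [ihf]
    simp only [_root_.map_sum, _root_.map_smul, ihg, interp_comp_apply, Finset.sum_smul,
      Finset.smul_sum, smul_smul]
    exact Finset.sum_comm
  | @tensor m n m' n' f g ihf ihg =>
    have h := F.map_tensorHom_mu (A := ⟨m⟩) (B := ⟨n⟩) (A' := ⟨m'⟩) (B' := ⟨n'⟩) (TL.cls f)
      (TL.cls g) (F.wordBasis b m u.left) (F.wordBasis b m' u.right)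
    rw [ihf, ihg, mu_wordBasis, Word.append_left_right] at h
    refine h.trans ?_
    simp only [TensorProduct.sum_tmul, TensorProduct.tmul_sum, TensorProduct.smul_tmul_smul,
      _root_.map_sum, _root_.map_smul, mu_wordBasis, Word.sum_add, interp_tensor_apply,
      Word.left_append, Word.right_append]
    exact Finset.sum_comm
  | cap =>
    obtain ⟨x, y, rfl⟩ := Word.exists_eq_append u
    rw [← mu_wordBasis, wordBasis_one, wordBasis_one]
    refine (F.map_arc_mu _ _).trans ?_
    rw [Word.sum_zero, wordBasis_zero, ← _root_.map_smul, smul_eq_mul, mul_one]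
    rfl
  | cup =>
    rw [wordBasis_zero]
    refine ((F.wordBasis b (1 + 1)).sum_repr _).symm.trans ?_
    refine Finset.sum_congr rfl fun v _ => ?_
    rw [interp_cup_apply, cupMatrix, Matrix.of_apply]
    congr 3
    rw [← Word.append_left_right v]
    congr 1 <;> funext i <;> rw [Subsingleton.elim i 0] <;> rfl
  | zero =>
    refine (LinearMap.congr_fun F.map_zero _).trans ?_
    simp [interp]
  | @add m n f g ihf ihg =>
    refine (LinearMap.congr_fun (F.map_add (A := ⟨m⟩) (B := ⟨n⟩) (TL.cls f) (TL.cls g)) _).trans ?_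
    rw [LinearMap.add_apply, ihf, ihg]
    simp only [interp, Matrix.add_apply, add_smul, Finset.sum_add_distrib]
  | @smul m n c f ih =>
    refine (LinearMap.congr_fun (F.map_smul (A := ⟨m⟩) (B := ⟨n⟩) c (TL.cls f)) _).trans ?_
    rw [LinearMap.smul_apply, ih]
    simp only [interp, Matrix.smul_apply, smul_eq_mul, mul_smul, Finset.smul_sum]

theorem interp_eq {m n : ℕ} {f g : TLExpr m n} (h : TLRel d f g) :
    interp (F.formMatrix b) (F.cupMatrix b) f = interp (F.formMatrix b) (F.cupMatrix b) g := by
  ext u v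
  have e := (F.map_wordBasis b f u).symm.trans
    ((congrArg (fun φ => F.map (A := ⟨m⟩) (B := ⟨n⟩) φ (F.wordBasis b m u))
      (TL.cls_sound h)).trans (F.map_wordBasis b g u))
  have e' := congrArg (fun x => (F.wordBasis b n).repr x v) e
  simpa [Finsupp.single_apply] using e'

theorem formMatrix_mul_cupMatrix : F.formMatrix b * F.cupMatrix b = 1 := by
  ext i j
  rw [← interp_zigzag_left, F.interp_eq b TLRel.zigzag_left, Matrix.one_apply]
  exact if_congr (funext_iff.trans (by simp [Word.cast])) rfl rfl

theorem cupMatrix_mul_formMatrix : F.cupMatrix b * F.formMatrix b = 1 :=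
  mul_eq_one_comm.1 (F.formMatrix_mul_cupMatrix b)

theorem sum_cupMatrix_mul_formMatrix :
    ∑ i, ∑ j, F.cupMatrix b i j * F.formMatrix b i j = d := by
  rw [← interp_loop Fin.elim0 Fin.elim0, F.interp_eq b TLRel.loop]
  simp [interp]

theorem cupMatrix_eq_inv : F.cupMatrix b = (F.formMatrix b)⁻¹ :=
  (Matrix.inv_eq_right_inv (F.formMatrix_mul_cupMatrix b)).symm

theorem hasForm_iff {E : Matrix (Fin 2) (Fin 2) ℂ} :
    F.HasForm E ↔ ∃ b : Module.Basis (Fin 2) ℂ (F.space TL.X), F.formMatrix b = E :=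
  exists_congr fun _ => Matrix.ext_iff

/-- A change of basis changes the matrix of the form by congruence. -/
theorem HasForm.congr {F : FiberFunctor d} {E E' : Matrix (Fin 2) (Fin 2) ℂ} (h : F.HasForm E)
    (hE : MatCongruent E E') : F.HasForm E' := by
  obtain ⟨b, hb⟩ := h
  obtain ⟨T, rfl⟩ := hE
  have hT : IsUnit T.val.det := (Matrix.isUnit_iff_isUnit_det _).1 T.isUnit
  refine ⟨b.map (Matrix.toLinearEquiv b T.val hT), fun i j => ?_⟩
  have e : ∀ i, b.map (Matrix.toLinearEquiv b T.val hT) i = ∑ k, T.val k i • b k := fun i => by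
    rw [Module.Basis.map_apply]; exact Matrix.toLin_self b b T.val i
  simp only [e, Fin.sum_univ_two, TensorProduct.add_tmul, TensorProduct.tmul_add,
    TensorProduct.smul_tmul_smul, _root_.map_add, _root_.map_smul, hb, Matrix.mul_apply,
    Matrix.transpose_apply, smul_eq_mul]
  ring

/-- Two matrices of the same form are congruent. -/
theorem HasForm.matCongruent {F : FiberFunctor d} {E E' : Matrix (Fin 2) (Fin 2) ℂ}
    (h : F.HasForm E) (h' : F.HasForm E') : MatCongruent E E' := by
  obtain ⟨b, hb⟩ := h
  obtain ⟨b', hb'⟩ := h'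
  refine ⟨⟨b.toMatrix b', b'.toMatrix b, b.toMatrix_mul_toMatrix_flip b',
    b'.toMatrix_mul_toMatrix_flip b⟩, ?_⟩
  ext i j
  rw [← hb', ← b.sum_toMatrix_smul_self b' i, ← b.sum_toMatrix_smul_self b' j]
  simp only [Fin.sum_univ_two, TensorProduct.add_tmul, TensorProduct.tmul_add,
    TensorProduct.smul_tmul_smul, _root_.map_add, _root_.map_smul, hb, Matrix.mul_apply,
    Matrix.transpose_apply, smul_eq_mul]
  ring

/-- Equivalent fiber functors have the same forms. -/
theorem Equivalent.hasForm {F G : FiberFunctor d} (h : F.Equivalent G)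
    {E : Matrix (Fin 2) (Fin 2) ℂ} (hE : F.HasForm E) : G.HasForm E := by
  obtain ⟨t, ht⟩ := h
  obtain ⟨b, hb⟩ := hE
  let e := fun A : TL d => FGModuleCat.isoToLinearEquiv (t.app A)
  have h0 : ∀ c, e _ (F.unit c) = G.unit c := fun c =>
    congrArg (fun φ => φ.hom.hom c) ht.unit
  have h1 : ∀ A B x y, e (A ⊗ B) (F.mu A B (x ⊗ₜ y)) = G.mu A B (e A x ⊗ₜ e B y) :=
    fun A B x y => congrArg (fun φ => φ.hom.hom (x ⊗ₜ[ℂ] y)) (ht.tensor A B)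
  have h2 : ∀ {A B : TL d} (f : A ⟶ B) x, e B (F.map f x) = G.map f (e A x) :=
    fun f x => congrArg (fun φ => φ.hom.hom x) (t.hom.naturality f)
  refine ⟨b.map (e TL.X), fun i j => ?_⟩
  rw [← hb]
  apply G.unitEquiv.injective
  rw [unitEquiv_apply, unitEquiv_apply, ← h0 (F.form (b i ⊗ₜ b j)), ← map_arc_mu, ← map_arc_mu, h2, h1]
  rfl

/-- Fiber functors with the same form are monoidally equivalent: identify the word bases. -/
theorem equivalent_of_hasForm {F G : FiberFunctor d} {E : Matrix (Fin 2) (Fin 2) ℂ}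
    (hF : F.HasForm E) (hG : G.HasForm E) : F.Equivalent G := by
  obtain ⟨b, hb⟩ := F.hasForm_iff.1 hF
  obtain ⟨c, hc⟩ := G.hasForm_iff.1 hG
  have hD : F.cupMatrix b = G.cupMatrix c := by rw [cupMatrix_eq_inv, cupMatrix_eq_inv, hb, hc]
  let e := fun A : TL d => (F.wordBasis b A.n).equiv (G.wordBasis c A.n) (Equiv.refl _)
  have he : ∀ A u, e A (F.wordBasis b A.n u) = G.wordBasis c A.n u := fun A u =>
    (F.wordBasis b A.n).equiv_apply _ _ _
  refine ⟨NatIso.ofComponents (fun A => LinearEquiv.toFGModuleCatIso (e A)) ?_, ?_, ?_⟩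
  · rintro A B ⟨f⟩
    apply FGModuleCat.hom_ext
    refine (F.wordBasis b A.n).ext fun u => ?_
    change e B (F.map (TL.cls f : A ⟶ B) _) = G.map (TL.cls f : A ⟶ B) (e A _)
    rw [he]
    refine (congrArg (e B) (F.map_wordBasis b f u)).trans ((G.map_wordBasis c f u).trans ?_).symm
    rw [_root_.map_sum]
    simp only [_root_.map_smul, he, hb, hc, hD]
  · apply FGModuleCat.hom_ext
    refine LinearMap.ext_ring ?_
    change e _ (F.unit 1) = G.unit 1
    rw [← F.wordBasis_zero b Fin.elim0, ← G.wordBasis_zero c Fin.elim0]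
    exact he _ _
  · intro A B
    apply FGModuleCat.hom_ext
    refine ((F.wordBasis b A.n).tensorProduct (F.wordBasis b B.n)).ext fun ⟨u, v⟩ => ?_
    rw [Module.Basis.tensorProduct_apply]
    change e _ (F.mu A B _) = G.mu A B (e A _ ⊗ₜ e B _)
    rw [he, he]
    exact (congrArg (e (A ⊗ B)) (F.mu_wordBasis b u v)).trans
      ((he _ _).trans (G.mu_wordBasis c u v).symm)

end FiberFunctor

/-! ### Matrix coefficients of words -/

section WordCoeff

variable {R : Type} [Ring R]

/-- The product `x_{v₁ u₁} ⋯ x_{vₙ uₙ}`: the coefficients of the `n`-th tensor power of the matrix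
`x`. -/
def wordCoeff (x : Fin 2 × Fin 2 → R) {n : ℕ} (v u : Word n) : R :=
  (List.ofFn fun i => x (v i, u i)).prod

theorem wordCoeff_zero (x : Fin 2 × Fin 2 → R) (v u : Word 0) : wordCoeff x v u = 1 := by
  simp [wordCoeff]

theorem wordCoeff_one (x : Fin 2 × Fin 2 → R) (v u : Word 1) :
    wordCoeff x v u = x (v 0, u 0) := by
  simp [wordCoeff]

theorem wordCoeff_append (x : Fin 2 × Fin 2 → R) {m n : ℕ} (v u : Word m) (v' u' : Word n) :
    wordCoeff x (Fin.append v v') (Fin.append u u') = wordCoeff x v u * wordCoeff x v' u' := by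
  rw [wordCoeff, wordCoeff, wordCoeff, ← List.prod_append, ← List.ofFn_fin_append]
  congr 2
  funext i
  induction i using Fin.addCases <;> simp

variable [Algebra ℂ R]

theorem map_wordCoeff {S : Type} [Ring S] [Algebra ℂ S] (f : R →ₐ[ℂ] S) (x : Fin 2 × Fin 2 → R)
    {n : ℕ} (v u : Word n) : f (wordCoeff x v u) = wordCoeff (fun p => f (x p)) v u := by
  rw [wordCoeff, wordCoeff, map_list_prod, List.map_ofFn]
  rfl

/-- A matrix satisfying the quadratic relations intertwines all tangles. -/
theorem QuadRel.sum_interp {E D : Matrix (Fin 2) (Fin 2) ℂ} {x : Fin 2 × Fin 2 → R}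
    (hx : QuadRel E D x) {m n : ℕ} (f : TLExpr m n) (u : Word m) (w : Word n) :
    ∑ v, interp E D f u v • wordCoeff x w v = ∑ v, interp E D f v w • wordCoeff x v u := by
  induction f with
  | ident h =>
    subst h
    simp [interp_ident_rfl, Matrix.one_apply]
  | @comp l m n f g ihf ihg =>
    calc ∑ v, interp E D (f.comp g) u v • wordCoeff x w v
        = ∑ t, interp E D f u t • ∑ v, interp E D g t v • wordCoeff x w v := by
          simp only [interp_comp_apply, Finset.sum_smul, Finset.smul_sum, smul_smul]
          exact Finset.sum_comm
      _ = ∑ s, interp E D g s w • ∑ t, interp E D f u t • wordCoeff x s t := by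
          simp only [ihg, Finset.smul_sum]
          rw [Finset.sum_comm]
          simp only [smul_comm (interp E D f _ _)]
      _ = _ := by
          simp only [ihf, interp_comp_apply, Finset.sum_smul, Finset.smul_sum, smul_smul,
            mul_comm (interp E D g _ _)]
          exact Finset.sum_comm
  | @tensor m n m' n' f g ihf ihg =>
    obtain ⟨u, u', rfl⟩ := Word.exists_eq_append u
    obtain ⟨w, w', rfl⟩ := Word.exists_eq_append w
    simp only [interp_tensor_apply, Word.sum_add, wordCoeff_append, Word.left_append,
      Word.right_append, ← smul_mul_smul_comm, ← Finset.sum_mul_sum, ihf, ihg]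
  | cap =>
    obtain ⟨u, u', rfl⟩ := Word.exists_eq_append u
    rw [Word.sum_zero, Word.sum_add]
    simp only [interp_cap_apply, wordCoeff_zero, Word.sum_one, wordCoeff_append, wordCoeff_one,
      Word.append_const_zero, Word.append_const_one]
    exact (hx.1 (u 0) (u' 0)).symm
  | cup =>
    obtain ⟨w, w', rfl⟩ := Word.exists_eq_append w
    rw [Word.sum_zero, Word.sum_add]
    simp only [interp_cup_apply, wordCoeff_zero, Word.sum_one, wordCoeff_append, wordCoeff_one,
      Word.append_const_zero, Word.append_const_one]
    exact hx.2 (w 0) (w' 0)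
  | zero => simp [interp]
  | add f g ihf ihg =>
    simp only [interp, Matrix.add_apply, add_smul, Finset.sum_add_distrib, ihf, ihg]
  | smul c f ih =>
    simp only [interp, Matrix.smul_apply, smul_assoc, ← Finset.smul_sum, ih]

end WordCoeff

/-! ### Linear maps out of an algebra given by generators and relations -/

/-- A linear map which does not distinguish the two sides of a relation, even after multiplication
from the left and from the right, is well defined on the quotient algebra. -/
theorem eq_of_mkAlgHom_eq {A B : Type} [Ring A] [Algebra ℂ A] [AddCommGroup B] [Module ℂ B]
    {r : A → A → Prop} (φ : A →ₗ[ℂ] B)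
    (hφ : ∀ a b, r a b → ∀ p q, φ (p * a * q) = φ (p * b * q)) {a b : A}
    (h : RingQuot.mkAlgHom ℂ r a = RingQuot.mkAlgHom ℂ r b) : φ a = φ b := by
  have key : ∀ {a b}, RingQuot.Rel r a b → ∀ p q, φ (p * a * q) = φ (p * b * q) := by
    intro a b hab
    induction hab with
    | of h => exact hφ _ _ h
    | add_left _ ih => intro p q; simp only [mul_add, add_mul, map_add, ih]
    | @mul_left a b c _ ih => intro p q; simpa only [mul_assoc] using ih p (c * q)
    | @mul_right a b c _ ih => intro p q; simpa only [mul_assoc] using ih (p * a) q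
  have h' : RingQuot.mkRingHom r a = RingQuot.mkRingHom r b := by
    rw [← RingQuot.mkAlgHom_coe ℂ]; exact h
  simp only [RingQuot.mkRingHom_def, RingHom.coe_mk, MonoidHom.coe_mk, OneHom.coe_mk,
    RingQuot.mk.injEq] at h'
  have h2 := Quot.eqvGen_exact h'
  clear h h'
  induction h2 with
  | rel a b hab => simpa using key hab 1 1
  | refl => rfl
  | symm a b _ ih => exact ih.symm
  | trans a b c _ _ ih ih' => exact ih.trans ih'

/-- The relations which make a matrix of free generators intertwine all tangles. -/
inductive TangleRel (E D : Matrix (Fin 2) (Fin 2) ℂ) :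
    FreeAlgebra ℂ (Fin 2 × Fin 2) → FreeAlgebra ℂ (Fin 2 × Fin 2) → Prop
  | mk {m n : ℕ} (f : TLExpr m n) (u : Word m) (w : Word n) : TangleRel E D
      (∑ v, interp E D f u v • wordCoeff (FreeAlgebra.ι ℂ) w v)
      (∑ v, interp E D f v w • wordCoeff (FreeAlgebra.ι ℂ) v u)

theorem TangleRel.quadRel (E D : Matrix (Fin 2) (Fin 2) ℂ) :
    QuadRel E D (quotGen (TangleRel E D)) := by
  have h : ∀ {m n : ℕ} (f : TLExpr m n) (u : Word m) (w : Word n),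
      ∑ v, interp E D f u v • wordCoeff (quotGen (TangleRel E D)) w v =
        ∑ v, interp E D f v w • wordCoeff (quotGen (TangleRel E D)) v u := by
    intro m n f u w
    have := RingQuot.mkAlgHom_rel ℂ (TangleRel.mk (E := E) (D := D) f u w)
    simp only [map_sum, map_smul, map_wordCoeff] at this
    exact this
  constructor
  · intro i j
    have := h .cap (Fin.append (fun _ => i) (fun _ => j)) Fin.elim0
    rw [Word.sum_zero, Word.sum_add] at this
    simp only [interp_cap_apply, wordCoeff_zero, Word.sum_one, wordCoeff_append,
      wordCoeff_one, Word.append_const_zero, Word.append_const_one] at this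
    exact this.symm
  · intro i j
    have := h .cup Fin.elim0 (Fin.append (fun _ => i) (fun _ => j))
    rw [Word.sum_zero, Word.sum_add] at this
    simp only [interp_cup_apply, wordCoeff_zero, Word.sum_one, wordCoeff_append,
      wordCoeff_one, Word.append_const_zero, Word.append_const_one] at this
    exact this

/-- What holds in an algebra presented by the quadratic relations holds modulo the relations
`TangleRel`, since the generators of the latter quotient satisfy the quadratic relations. -/
theorem Presents.mk_tangleRel_eq
    {r : FreeAlgebra ℂ (Fin 2 × Fin 2) → FreeAlgebra ℂ (Fin 2 × Fin 2) → Prop}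
    {E D : Matrix (Fin 2) (Fin 2) ℂ} (h : Presents r E D) {a b : FreeAlgebra ℂ (Fin 2 × Fin 2)}
    (hab : RingQuot.mkAlgHom ℂ r a = RingQuot.mkAlgHom ℂ r b) :
    RingQuot.mkAlgHom ℂ (TangleRel E D) a = RingQuot.mkAlgHom ℂ (TangleRel E D) b := by
  have e : (quotLift h _ (TangleRel.quadRel E D)).comp (RingQuot.mkAlgHom ℂ r) =
      RingQuot.mkAlgHom ℂ (TangleRel E D) := by
    ext p
    exact quotLift_gen h _ _ p
  rw [← e]
  exact congrArg (quotLift h _ (TangleRel.quadRel E D)) hab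

/-- Every product of free generators is the coefficient of a pair of words. -/
theorem basisFreeMonoid_eq_wordCoeff (l : FreeMonoid (Fin 2 × Fin 2)) :
    FreeAlgebra.basisFreeMonoid ℂ (Fin 2 × Fin 2) l =
      wordCoeff (FreeAlgebra.ι ℂ) (fun i : Fin l.toList.length => (l.toList.get i).1)
        (fun i => (l.toList.get i).2) := by
  have h : FreeAlgebra.basisFreeMonoid ℂ (Fin 2 × Fin 2) l =
      FreeMonoid.lift (FreeAlgebra.ι ℂ) l := by
    simp [FreeAlgebra.basisFreeMonoid, FreeAlgebra.equivMonoidAlgebraFreeMonoid]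
  rw [h, wordCoeff, FreeMonoid.lift_apply]
  congr 1
  exact (List.ofFn_getElem_eq_map _ _).symm

/-- Linear maps from the free algebra are given by arbitrary values on the coefficients of words. -/
theorem exists_linearMap_wordCoeff {B : Type} [AddCommGroup B] [Module ℂ B]
    (s : ∀ n : ℕ, Word n → Word n → B) :
    ∃ φ : FreeAlgebra ℂ (Fin 2 × Fin 2) →ₗ[ℂ] B,
      ∀ (n : ℕ) (v u : Word n), φ (wordCoeff (FreeAlgebra.ι ℂ) v u) = s n v u := by
  refine ⟨(FreeAlgebra.basisFreeMonoid ℂ (Fin 2 × Fin 2)).constr ℂ fun l =>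
    s l.toList.length (fun i => (l.toList.get i).1) (fun i => (l.toList.get i).2), fun n v u => ?_⟩
  have h := basisFreeMonoid_eq_wordCoeff (FreeMonoid.ofList (List.ofFn fun i => (v i, u i)))
  have key : ∀ (m : ℕ) (g : Fin m → Fin 2 × Fin 2) (hm : m = n)
      (hg : ∀ i, g i = (v (Fin.cast hm i), u (Fin.cast hm i))),
      wordCoeff (FreeAlgebra.ι ℂ) (fun i => (g i).1) (fun i => (g i).2) =
        wordCoeff (FreeAlgebra.ι ℂ) v u ∧
      s m (fun i => (g i).1) (fun i => (g i).2) = s n v u := by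
    rintro m g rfl hg
    obtain rfl : g = fun i => (v i, u i) := funext hg
    exact ⟨rfl, rfl⟩
  obtain ⟨k1, k2⟩ := key _ ((List.ofFn fun i => (v i, u i)).get) List.length_ofFn
    fun i => by rw [List.get_ofFn]
  rw [← k1]
  refine (congrArg _ h.symm).trans ((Module.Basis.constr_basis _ _ _ _).trans k2)

theorem freeAlgebra_wordCoeff_induction {P : FreeAlgebra ℂ (Fin 2 × Fin 2) → Prop}
    (word : ∀ (n : ℕ) (v u : Word n), P (wordCoeff (FreeAlgebra.ι ℂ) v u))
    (add : ∀ x y, P x → P y → P (x + y)) (smul : ∀ (c : ℂ) (x), P x → P (c • x))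
    (x : FreeAlgebra ℂ (Fin 2 × Fin 2)) : P x := by
  have hx := (FreeAlgebra.basisFreeMonoid ℂ (Fin 2 × Fin 2)).mem_span x
  induction hx using Submodule.span_induction with
  | mem x hx =>
    obtain ⟨l, rfl⟩ := hx
    rw [basisFreeMonoid_eq_wordCoeff]
    exact word _ _ _
  | zero => simpa using smul 0 _ (word 0 Fin.elim0 Fin.elim0)
  | add x y _ _ hx hy => exact add x y hx hy
  | smul c x _ hx => exact smul c x hx

/-! ### The Hopf algebra associated to a fiber functor -/

section Coeff

variable {r : FreeAlgebra ℂ (Fin 2 × Fin 2) → FreeAlgebra ℂ (Fin 2 × Fin 2) → Prop}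
  {E D : Matrix (Fin 2) (Fin 2) ℂ}

theorem quotComul_wordCoeff (h : Presents r E D) {n : ℕ} (v u : Word n) :
    quotComul h (wordCoeff (quotGen r) v u) =
      ∑ w, wordCoeff (quotGen r) v w ⊗ₜ[ℂ] wordCoeff (quotGen r) w u := by
  induction n with
  | zero =>
    rw [Word.sum_zero]
    simp only [wordCoeff_zero, map_one]
    rfl
  | succ n ih =>
    obtain ⟨v, v', rfl⟩ := Word.exists_eq_append v
    obtain ⟨u, u', rfl⟩ := Word.exists_eq_append u
    rw [wordCoeff_append, map_mul, ih, wordCoeff_one, quotComul_gen]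
    simp only [Word.sum_add, Word.sum_one, wordCoeff_append, wordCoeff_one, Finset.sum_mul_sum,
      Algebra.TensorProduct.tmul_mul_tmul]

theorem quotCounit_wordCoeff (h : Presents r E D) {n : ℕ} (v u : Word n) :
    quotCounit h (wordCoeff (quotGen r) v u) = if v = u then 1 else 0 := by
  induction n with
  | zero => rw [wordCoeff_zero, map_one, if_pos (Subsingleton.elim _ _)]
  | succ n ih =>
    obtain ⟨v, v', rfl⟩ := Word.exists_eq_append v
    obtain ⟨u, u', rfl⟩ := Word.exists_eq_append u
    rw [wordCoeff_append, map_mul, ih, wordCoeff_one, quotCounit_gen, ite_zero_mul_ite_zero]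
    refine if_congr ?_ (mul_one _) rfl
    rw [Word.ext_iff_left_right (m := n) (n := 1)]
    simp [funext_iff (f := v')]

end Coeff

namespace FiberFunctor

variable {d : ℂ} (F : FiberFunctor d) (b : Module.Basis (Fin 2) ℂ (F.space TL.X))

/-- The coefficients of a natural transformation `F → F ⊗ B` in the word basis. -/
noncomputable def NatTensor.coeff {F : FiberFunctor d} {B : Type} [AddCommGroup B] [Module ℂ B]
    (σ : F.NatTensor B) (b : Module.Basis (Fin 2) ℂ (F.space TL.X)) (n : ℕ) (v u : Word n) : B :=
  TensorProduct.equivFinsuppOfBasisLeft (F.wordBasis b n) (σ.app ⟨n⟩ (F.wordBasis b n u)) v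

theorem coeff_sum_tmul {B : Type} [AddCommGroup B] [Module ℂ B] (n : ℕ) (s : Word n → B)
    (v : Word n) :
    TensorProduct.equivFinsuppOfBasisLeft (F.wordBasis b n) (∑ w, F.wordBasis b n w ⊗ₜ[ℂ] s w) v =
      s v := by
  rw [_root_.map_sum, Finsupp.finsetSum_apply]
  simp only [TensorProduct.equivFinsuppOfBasisLeft_apply_tmul_apply, Module.Basis.repr_self,
    Finsupp.single_apply, ite_smul, one_smul, zero_smul]
  simp

theorem NatTensor.app_wordBasis {F : FiberFunctor d} {B : Type} [AddCommGroup B] [Module ℂ B]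
    (σ : F.NatTensor B) (b : Module.Basis (Fin 2) ℂ (F.space TL.X)) (n : ℕ) (u : Word n) :
    σ.app ⟨n⟩ (F.wordBasis b n u) = ∑ v, F.wordBasis b n v ⊗ₜ[ℂ] σ.coeff b n v u := by
  apply (TensorProduct.equivFinsuppOfBasisLeft (F.wordBasis b n)).injective
  ext v
  rw [coeff_sum_tmul]
  rfl

theorem NatTensor.sum_interp_smul_coeff {F : FiberFunctor d} {B : Type} [AddCommGroup B]
    [Module ℂ B] (σ : F.NatTensor B) (b : Module.Basis (Fin 2) ℂ (F.space TL.X)) {m n : ℕ}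
    (f : TLExpr m n) (u : Word m) (w : Word n) :
    ∑ v, interp (F.formMatrix b) (F.cupMatrix b) f u v • σ.coeff b n w v =
      ∑ v, interp (F.formMatrix b) (F.cupMatrix b) f v w • σ.coeff b m v u := by
  have h := LinearMap.congr_fun (σ.naturality (A := ⟨m⟩) (A' := ⟨n⟩) (TL.cls f))
    (F.wordBasis b m u)
  rw [LinearMap.comp_apply, LinearMap.comp_apply, map_wordBasis, σ.app_wordBasis] at h
  simp only [_root_.map_sum, _root_.map_smul, σ.app_wordBasis, LinearMap.rTensor_tmul,
    map_wordBasis, TensorProduct.sum_tmul, Finset.smul_sum, TensorProduct.smul_tmul] at h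
  rw [Finset.sum_comm, Finset.sum_comm (γ := Word m)] at h
  simp only [← TensorProduct.tmul_smul, ← TensorProduct.tmul_sum] at h
  have h' := congrArg (fun x => TensorProduct.equivFinsuppOfBasisLeft (F.wordBasis b n) x w) h
  simpa only [coeff_sum_tmul] using h'

/-- The coaction `e_u ↦ ∑ e_v ⊗ x_{v₁ u₁} ⋯ x_{vₙ uₙ}` of a matrix `x` on the word bases. -/
noncomputable def coaction {R : Type} [Ring R] [Algebra ℂ R] (x : Fin 2 × Fin 2 → R) (n : ℕ) :
    F.space ⟨n⟩ →ₗ[ℂ] F.space ⟨n⟩ ⊗[ℂ] R :=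
  (F.wordBasis b n).constr ℂ fun u => ∑ v, F.wordBasis b n v ⊗ₜ[ℂ] wordCoeff x v u

theorem coaction_wordBasis {R : Type} [Ring R] [Algebra ℂ R] (x : Fin 2 × Fin 2 → R) {n : ℕ}
    (u : Word n) : F.coaction b x n (F.wordBasis b n u) =
      ∑ v, F.wordBasis b n v ⊗ₜ[ℂ] wordCoeff x v u :=
  (F.wordBasis b n).constr_basis ℂ _ u

/-- The natural transformation `F → F ⊗ R` given by a matrix over `R` which satisfies the quadratic
relations of the form. -/
noncomputable def natTensor {R : Type} [Ring R] [Algebra ℂ R] {x : Fin 2 × Fin 2 → R}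
    (hx : QuadRel (F.formMatrix b) (F.cupMatrix b) x) : F.NatTensor R where
  app A := F.coaction b x A.n
  naturality := by
    have key : ∀ {m n : ℕ} (f : TLExpr m n),
        F.coaction b x n ∘ₗ F.map (TL.cls f : (⟨m⟩ : TL d) ⟶ ⟨n⟩) =
          (F.map (TL.cls f : (⟨m⟩ : TL d) ⟶ ⟨n⟩)).rTensor R ∘ₗ F.coaction b x m := by
      intro m n f
      refine (F.wordBasis b m).ext fun u => ?_
      rw [LinearMap.comp_apply, LinearMap.comp_apply, coaction_wordBasis, map_wordBasis]
      simp only [_root_.map_sum, _root_.map_smul, coaction_wordBasis, LinearMap.rTensor_tmul,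
        map_wordBasis, TensorProduct.sum_tmul, Finset.smul_sum, TensorProduct.smul_tmul]
      rw [Finset.sum_comm, Finset.sum_comm (γ := Word m)]
      simp only [← TensorProduct.tmul_smul, ← TensorProduct.tmul_sum, hx.sum_interp f u]
    rintro A A' ⟨f⟩
    exact key f

theorem natTensor_app {R : Type} [Ring R] [Algebra ℂ R] {x : Fin 2 × Fin 2 → R}
    (hx : QuadRel (F.formMatrix b) (F.cupMatrix b) x) {n : ℕ} (u : Word n) :
    (F.natTensor b hx).app ⟨n⟩ (F.wordBasis b n u) =
      ∑ v, F.wordBasis b n v ⊗ₜ[ℂ] wordCoeff x v u :=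
  F.coaction_wordBasis b x u

/-- The coefficients of a natural transformation satisfy all linear consequences of the quadratic
relations: apply naturality to a tangle with parallel strings added on both sides. -/
theorem NatTensor.linearMap_mul_mul_eq {F : FiberFunctor d} {B : Type} [AddCommGroup B]
    [Module ℂ B] (σ : F.NatTensor B) (b : Module.Basis (Fin 2) ℂ (F.space TL.X))
    {φ : FreeAlgebra ℂ (Fin 2 × Fin 2) →ₗ[ℂ] B}
    (hφ : ∀ (n : ℕ) (v u : Word n), φ (wordCoeff (FreeAlgebra.ι ℂ) v u) = σ.coeff b n v u)
    {s t : FreeAlgebra ℂ (Fin 2 × Fin 2)}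
    (hst : TangleRel (F.formMatrix b) (F.cupMatrix b) s t) (p q : FreeAlgebra ℂ (Fin 2 × Fin 2)) :
    φ (p * s * q) = φ (p * t * q) := by
  obtain ⟨f, u, w⟩ := hst
  rename_i m n
  induction p using freeAlgebra_wordCoeff_induction with
  | add p p' hp hp' => simp only [add_mul, _root_.map_add, hp, hp']
  | smul c p hp => simp only [smul_mul_assoc, _root_.map_smul, hp]
  | word k v₁ u₁ =>
  induction q using freeAlgebra_wordCoeff_induction with
  | add q q' hq hq' => simp only [mul_add, _root_.map_add, hq, hq']
  | smul c q hq => simp only [mul_smul_comm, _root_.map_smul, hq]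
  | word l v₂ u₂ =>
  -- Naturality for the tangle `f` with `k` parallel strings on its left and `l` on its right.
  have h := σ.sum_interp_smul_coeff b
    (((TLExpr.ident (rfl : k = k)).tensor f).tensor (TLExpr.ident (rfl : l = l)))
    (Fin.append (Fin.append u₁ u) u₂) (Fin.append (Fin.append v₁ w) v₂)
  simp only [interp_tensor_apply, Word.sum_add, Word.left_append, Word.right_append,
    interp_ident_rfl, Matrix.one_apply, ite_mul, mul_ite, one_mul, mul_one, zero_mul, mul_zero,
    ite_smul, zero_smul, Finset.sum_ite_eq, Finset.sum_ite_eq', Finset.mem_univ, if_true,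
    Finset.sum_ite_irrel, Finset.sum_const_zero] at h
  simp only [Finset.mul_sum, Finset.sum_mul, mul_smul_comm, smul_mul_assoc, ← wordCoeff_append,
    _root_.map_sum, _root_.map_smul, hφ]
  exact h

/-- The Hopf algebra associated to a fiber functor with the form `E` is the one presented by the
quadratic relations of `E` and its inverse. -/
theorem HasForm.isAssociatedHopfAlgebra {F : FiberFunctor d}
    {r : FreeAlgebra ℂ (Fin 2 × Fin 2) → FreeAlgebra ℂ (Fin 2 × Fin 2) → Prop}
    {E D : Matrix (Fin 2) (Fin 2) ℂ} (hF : F.HasForm E) (h : Presents r E D) (hDE : D * E = 1) :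
    letI := quotHopf h hDE
    F.IsAssociatedHopfAlgebra (RingQuot r) := by
  let _ := quotHopf h hDE
  obtain ⟨b, rfl⟩ := F.hasForm_iff.1 hF
  obtain rfl : D = F.cupMatrix b := by
    rw [cupMatrix_eq_inv, Matrix.inv_eq_left_inv hDE]
  have hx := quotGen_rel h
  refine ⟨F.natTensor b hx, ?_, ?_, ?_, ?_, ?_⟩
  · intro B _ _ σ
    obtain ⟨φ, hφ⟩ := exists_linearMap_wordCoeff (σ.coeff b)
    -- `φ` vanishes on the ideal of relations, so composing it with any linear section of the
    -- quotient map gives the linear map induced on the quotient.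
    obtain ⟨g, hg⟩ := (RingQuot.mkAlgHom ℂ r).toLinearMap.exists_rightInverse_of_surjective
      (LinearMap.range_eq_top.2 (RingQuot.mkAlgHom_surjective ℂ r))
    have hg' : ∀ y, RingQuot.mkAlgHom ℂ r (g y) = y := fun y => LinearMap.congr_fun hg y
    have hgen : ∀ {n : ℕ} (v u : Word n), wordCoeff (quotGen r) v u =
        RingQuot.mkAlgHom ℂ r (wordCoeff (FreeAlgebra.ι ℂ) v u) := fun v u => by
      rw [map_wordCoeff]; rfl
    have hψ : ∀ {n : ℕ} (v u : Word n), φ (g (wordCoeff (quotGen r) v u)) = σ.coeff b n v u := by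
      intro n v u
      rw [← hφ, hgen]
      exact eq_of_mkAlgHom_eq φ (fun _ _ hst => σ.linearMap_mul_mul_eq b hφ hst)
        (h.mk_tangleRel_eq (hg' _))
    refine ⟨φ ∘ₗ g, fun Y => ?_, fun ψ' hψ' => ?_⟩
    · obtain ⟨n⟩ := Y
      refine (F.wordBasis b n).ext fun u => ?_
      rw [LinearMap.comp_apply, natTensor_app, σ.app_wordBasis, _root_.map_sum]
      simp only [LinearMap.lTensor_tmul, LinearMap.comp_apply, hψ]
    · refine LinearMap.ext fun y => ?_
      obtain ⟨a, rfl⟩ := RingQuot.mkAlgHom_surjective ℂ r y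
      induction a using freeAlgebra_wordCoeff_induction with
      | add p p' hp hp' => simp only [_root_.map_add, hp, hp']
      | smul c p hp => simp only [_root_.map_smul, hp]
      | word n v u =>
        rw [← hgen, LinearMap.comp_apply, hψ, NatTensor.coeff, hψ' ⟨n⟩, LinearMap.comp_apply,
          natTensor_app]
        simp only [_root_.map_sum, LinearMap.lTensor_tmul]
        rw [← _root_.map_sum, coeff_sum_tmul]
  · rintro ⟨n⟩ v
    have e : (Coalgebra.comul (R := ℂ) (A := RingQuot r)).lTensor (F.space ⟨n⟩) ∘ₗ
        (F.natTensor b hx).app ⟨n⟩ =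
        (TensorProduct.assoc ℂ (F.space ⟨n⟩) (RingQuot r) (RingQuot r)).toLinearMap ∘ₗ
          ((F.natTensor b hx).app ⟨n⟩).rTensor (RingQuot r) ∘ₗ (F.natTensor b hx).app ⟨n⟩ := by
      refine (F.wordBasis b n).ext fun u => ?_
      simp only [LinearMap.comp_apply, natTensor_app, _root_.map_sum, LinearMap.lTensor_tmul,
        LinearMap.rTensor_tmul, TensorProduct.sum_tmul, LinearEquiv.coe_coe,
        TensorProduct.assoc_tmul]
      rw [Finset.sum_comm]
      simp only [← TensorProduct.tmul_sum]
      refine Finset.sum_congr rfl fun v _ => congrArg _ ?_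
      exact quotComul_wordCoeff h v u
    exact LinearMap.congr_fun e v
  · rintro ⟨n⟩ v
    have e : (Coalgebra.counit (R := ℂ) (A := RingQuot r)).lTensor (F.space ⟨n⟩) ∘ₗ
        (F.natTensor b hx).app ⟨n⟩ = (TensorProduct.mk ℂ (F.space ⟨n⟩) ℂ).flip 1 := by
      refine (F.wordBasis b n).ext fun u => ?_
      have hc : ∀ v, Coalgebra.counit (R := ℂ) (A := RingQuot r) (wordCoeff (quotGen r) v u) =
          if v = u then 1 else 0 := fun v => quotCounit_wordCoeff h v u
      simp only [LinearMap.comp_apply, natTensor_app, _root_.map_sum, LinearMap.lTensor_tmul, hc,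
        TensorProduct.tmul_ite]
      simp
    exact LinearMap.congr_fun e v
  · rintro ⟨m⟩ ⟨n⟩ v w
    have e : (F.natTensor b hx).app (⟨m⟩ ⊗ ⟨n⟩) ∘ₗ F.mu ⟨m⟩ ⟨n⟩ =
        TensorProduct.map (F.mu ⟨m⟩ ⟨n⟩) (LinearMap.mul' ℂ (RingQuot r)) ∘ₗ
          (TensorProduct.tensorTensorTensorComm ℂ (F.space ⟨m⟩) (RingQuot r) (F.space ⟨n⟩)
            (RingQuot r)).toLinearMap ∘ₗ
          TensorProduct.map ((F.natTensor b hx).app ⟨m⟩) ((F.natTensor b hx).app ⟨n⟩) := by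
      refine ((F.wordBasis b m).tensorProduct (F.wordBasis b n)).ext fun ⟨u, u'⟩ => ?_
      rw [Module.Basis.tensorProduct_apply, LinearMap.comp_apply]
      refine (congrArg ((F.natTensor b hx).app (⟨m⟩ ⊗ ⟨n⟩)) (F.mu_wordBasis b u u')).trans ?_
      refine (F.natTensor_app b hx (Fin.append u u')).trans ?_
      simp only [LinearMap.comp_apply, natTensor_app, TensorProduct.map_tmul,
        TensorProduct.sum_tmul, TensorProduct.tmul_sum, _root_.map_sum, LinearEquiv.coe_coe,
        TensorProduct.tensorTensorTensorComm_tmul, LinearMap.mul'_apply, mu_wordBasis,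
        Word.sum_add, wordCoeff_append]
      exact Finset.sum_comm
    exact LinearMap.congr_fun e (v ⊗ₜ w)
  · rw [← F.wordBasis_zero b Fin.elim0]
    refine (F.natTensor_app b hx Fin.elim0).trans ?_
    rw [Word.sum_zero, wordCoeff_zero]

end FiberFunctor

/-! ### Classification of the two-dimensional fiber functors -/

namespace FiberFunctor

variable {d : ℂ}

/-- The form of a two-dimensional fiber functor is nondegenerate, and `d` is the trace of the
operator `Θ(E)`. -/
theorem exists_hasForm {F : FiberFunctor d} (hF : F.dim = 2) :
    ∃ E, F.HasForm E ∧ IsUnit E.det ∧ (Theta E).trace = d := by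
  let b := Module.finBasisOfFinrankEq ℂ (F.space TL.X) hF
  refine ⟨F.formMatrix b, F.hasForm_iff.2 ⟨b, rfl⟩, ?_, ?_⟩
  · exact (Matrix.isUnit_iff_isUnit_det _).1
      (.of_mul_eq_one _ (F.formMatrix_mul_cupMatrix b))
  · refine Eq.trans ?_ (F.sum_cupMatrix_mul_formMatrix b)
    rw [Theta, ← cupMatrix_eq_inv]
    simp [Matrix.trace_fin_two, Matrix.mul_apply]

theorem hasForm_genericForm_or_singularForm {F : FiberFunctor d} (hF : F.dim = 2) :
    (∃ q : ℂˣ, (q : ℂ) + (q : ℂ)⁻¹ = -d ∧ F.HasForm (genericForm q)) ∨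
      (d = -2 ∧ F.HasForm singularForm) := by
  obtain ⟨E, hE, hu, hd⟩ := exists_hasForm hF
  rcases matCongruent_genericForm_or_singularForm hu with ⟨q, hq⟩ | hs
  · refine Or.inl ⟨q, ?_, hE.congr hq.symm⟩
    rw [← hd, hq.trace_theta_eq, trace_theta_genericForm, neg_neg]
  · refine Or.inr ⟨?_, hE.congr hs.symm⟩
    rw [← hd, hs.trace_theta_eq, theta_singularForm]
    norm_num [Matrix.trace_fin_two]

theorem hasForm_genericForm {F : FiberFunctor d} (hd : d ≠ -2) (hF : F.dim = 2) {q : ℂˣ}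
    (hq : (q : ℂ) + (q : ℂ)⁻¹ = -d) : F.HasForm (genericForm q) := by
  rcases hasForm_genericForm_or_singularForm hF with ⟨q', hq', h⟩ | ⟨h, -⟩
  · exact h.congr ((matCongruent_genericForm_iff q' q).2
      (eq_or_eq_inv_of_add_inv_eq (hq'.trans hq.symm)))
  · exact absurd h hd

theorem exists_genericForm {q : ℂˣ} (hq : (q : ℂ) + (q : ℂ)⁻¹ = -d) :
    ∃ F : FiberFunctor d, F.dim = 2 ∧ F.HasForm (genericForm q) := by
  have hED : genericForm q * !![0, -(q : ℂ); 1, 0] = 1 := by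
    ext i j; fin_cases i <;> fin_cases j <;> simp [genericForm, Matrix.mul_apply]
  have hd : ∑ i, ∑ j, !![0, -(q : ℂ); 1, 0] i j * genericForm q i j = d := by
    simp [genericForm]
    linear_combination -hq
  exact ⟨stdFiberFunctor hED (mul_eq_one_comm.1 hED) hd, stdFiberFunctor_dim _ _ _,
    stdFiberFunctor_hasForm _ _ _⟩

theorem exists_singularForm :
    ∃ F : FiberFunctor (-2), F.dim = 2 ∧ F.HasForm singularForm := by
  have hED : singularForm * !![0, -1; 1, 1] = 1 := by
    ext i j; fin_cases i <;> fin_cases j <;> simp [singularForm, Matrix.mul_apply]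
  have hd : ∑ i, ∑ j, !![(0 : ℂ), -1; 1, 1] i j * singularForm i j = -2 := by
    simp [singularForm]
    norm_num
  exact ⟨stdFiberFunctor hED (mul_eq_one_comm.1 hED) hd, stdFiberFunctor_dim _ _ _,
    stdFiberFunctor_hasForm _ _ _⟩

theorem HasForm.isAssociatedHopfAlgebra_SLq {F : FiberFunctor d} {q : ℂˣ}
    (h : F.HasForm (genericForm q)) : F.IsAssociatedHopfAlgebra (SLq q) :=
  h.isAssociatedHopfAlgebra (SLqRel.presents q) (by
    ext i j; fin_cases i <;> fin_cases j <;> simp [genericForm, Matrix.mul_apply])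

/-- The form `E_s` in the basis in which its quadratic relations are those of Woronowicz. -/
theorem matCongruent_singularForm (τ : ℂˣ) :
    MatCongruent singularForm !![0, -1; 1, (τ : ℂ)] := by
  obtain ⟨s, hs⟩ := IsAlgClosed.exists_eq_mul_self (τ : ℂ)
  have hs0 : s ≠ 0 := by rintro rfl; simp at hs
  refine .of_det_ne_zero !![0, s; s⁻¹, 0] (by simp [Matrix.det_fin_two_of, hs0]) ?_
  ext i j
  fin_cases i <;> fin_cases j <;> simp [singularForm, Matrix.mul_apply, hs, hs0]

theorem HasForm.isAssociatedHopfAlgebra_Exc {F : FiberFunctor d} (h : F.HasForm singularForm)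
    (τ : ℂˣ) : F.IsAssociatedHopfAlgebra (Exc τ) :=
  (h.congr (matCongruent_singularForm τ)).isAssociatedHopfAlgebra (ExcRel.presents τ) (by
    ext i j; fin_cases i <;> fin_cases j <;> simp [Matrix.mul_apply])

end FiberFunctor

theorem exists_add_inv_eq (c : ℂ) : ∃ q : ℂˣ, (q : ℂ) + (q : ℂ)⁻¹ = c := by
  obtain ⟨s, hs⟩ := IsAlgClosed.exists_eq_mul_self (discrim 1 (-c) 1)
  obtain ⟨t, ht⟩ := exists_quadratic_eq_zero one_ne_zero ⟨s, hs⟩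
  have ht0 : t ≠ 0 := by rintro rfl; simp at ht
  refine ⟨Units.mk0 t ht0, ?_⟩
  rw [Units.val_mk0]
  field_simp
  linear_combination ht

theorem mainTheorem5 :
    -- congruence classes in `GL_2(ℂ)`: the generic orbits and exactly one further orbit
    ((∀ q : ℂˣ, IsUnit (genericForm q).det ∧
        Theta (genericForm q) = -!![(q : ℂ), 0; 0, (q : ℂ)⁻¹]) ∧
      (IsUnit singularForm.det ∧ Theta singularForm = !![-1, 0; 2, -1]) ∧
      (∀ q q' : ℂˣ, MatCongruent (genericForm q) (genericForm q') ↔ q' = q ∨ q' = q⁻¹) ∧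
      (∀ q : ℂˣ, ¬ MatCongruent (genericForm q) singularForm) ∧
      (∀ E : Matrix (Fin 2) (Fin 2) ℂ, IsUnit E.det →
        (∃ q : ℂˣ, MatCongruent (genericForm q) E) ∨ MatCongruent singularForm E)) ∧
    -- stabilizers
    ((∀ q : ℂˣ, q ≠ 1 → q ≠ -1 →
        (∀ T : GL (Fin 2) ℂ, T ∈ congStabilizer (genericForm q) ↔
          ∃ t : ℂˣ, T.val = !![(t : ℂ), 0; 0, (t : ℂ)⁻¹]) ∧
        Nonempty (congStabilizer (genericForm q) ≃* ℂˣ)) ∧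
      ((∀ T : GL (Fin 2) ℂ, T ∈ congStabilizer (genericForm (-1)) ↔
          (∃ s : ℂˣ, T.val = !![(s : ℂ), 0; 0, (s : ℂ)⁻¹]) ∨
          ∃ t : ℂˣ, T.val = !![0, (t : ℂ); (t : ℂ)⁻¹, 0]) ∧
        Nonempty (congStabilizer (genericForm (-1)) ≃*
          ℂˣ ⋊[inversionAction] Multiplicative (ZMod 2))) ∧
      ((∀ T : GL (Fin 2) ℂ, T ∈ congStabilizer (genericForm 1) ↔ T.val.det = 1) ∧
        Nonempty (congStabilizer (genericForm 1) ≃* Matrix.SpecialLinearGroup (Fin 2) ℂ)) ∧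
      ((∀ T : GL (Fin 2) ℂ, T ∈ congStabilizer singularForm ↔
          ∃ z : ℂ, T.val = !![1, 0; z, 1] ∨ T.val = !![-1, 0; z, -1]) ∧
        Nonempty (congStabilizer singularForm ≃*
          Multiplicative ℂ ⋊[(1 : Multiplicative (ZMod 2) →* MulAut (Multiplicative ℂ))]
            Multiplicative (ZMod 2)))) ∧
    -- two-dimensional fiber functors and their Hopf algebras for `d ≠ -2`
    (∀ d : ℂ, d ≠ 0 → d ≠ -2 →
      (∃ F : FiberFunctor d, F.dim = 2) ∧
      (∀ F G : FiberFunctor d, F.dim = 2 → G.dim = 2 → F.Equivalent G) ∧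
      (∃ q : ℂˣ, (q : ℂ) + (q : ℂ)⁻¹ = -d) ∧
      (∀ F : FiberFunctor d, F.dim = 2 → ∀ q : ℂˣ, (q : ℂ) + (q : ℂ)⁻¹ = -d →
        F.HasForm (genericForm q) ∧ F.IsAssociatedHopfAlgebra (SLq q))) ∧
    -- two-dimensional fiber functors and their Hopf algebras for `d = -2`
    (∃ F G : FiberFunctor (-2),
      (F.dim = 2 ∧ F.HasForm (genericForm 1) ∧ F.IsAssociatedHopfAlgebra (SLq 1)) ∧
      (G.dim = 2 ∧ G.HasForm singularForm ∧ ∀ τ : ℂˣ, G.IsAssociatedHopfAlgebra (Exc τ)) ∧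
      ¬ F.Equivalent G ∧
      ∀ H : FiberFunctor (-2), H.dim = 2 → H.Equivalent F ∨ H.Equivalent G) := by
  refine ⟨⟨fun q => ⟨isUnit_det_genericForm q, theta_genericForm q⟩,
      ⟨isUnit_det_singularForm, theta_singularForm⟩, matCongruent_genericForm_iff,
      not_matCongruent_genericForm_singularForm,
      fun _ => matCongruent_genericForm_or_singularForm⟩,
    ⟨fun q h1 h2 => ⟨mem_congStabilizer_genericForm_iff h1 h2,
        nonempty_congStabilizer_genericForm_mulEquiv h1 h2⟩,
      ⟨mem_congStabilizer_genericForm_neg_one_iff,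
        nonempty_congStabilizer_genericForm_neg_one_mulEquiv⟩,
      ⟨mem_congStabilizer_genericForm_one_iff,
        nonempty_congStabilizer_genericForm_one_mulEquiv⟩,
      mem_congStabilizer_singularForm_iff, nonempty_congStabilizer_singularForm_mulEquiv⟩,
    fun d _ hd => ?_, ?_⟩
  · obtain ⟨q, hq⟩ := exists_add_inv_eq (-d)
    obtain ⟨F, hF, -⟩ := FiberFunctor.exists_genericForm hq
    refine ⟨⟨F, hF⟩, fun G H hG hH => ?_, ⟨q, hq⟩, fun G hG q' hq' => ?_⟩
    · exact FiberFunctor.equivalent_of_hasForm (FiberFunctor.hasForm_genericForm hd hG hq)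
        (FiberFunctor.hasForm_genericForm hd hH hq)
    · have h := FiberFunctor.hasForm_genericForm hd hG hq'
      exact ⟨h, h.isAssociatedHopfAlgebra_SLq⟩
  · have h1 : ((1 : ℂˣ) : ℂ) + ((1 : ℂˣ) : ℂ)⁻¹ = -(-2) := by norm_num
    obtain ⟨F, hF, hF'⟩ := FiberFunctor.exists_genericForm h1
    obtain ⟨G, hG, hG'⟩ := FiberFunctor.exists_singularForm
    refine ⟨F, G, ⟨hF, hF', hF'.isAssociatedHopfAlgebra_SLq⟩,
      ⟨hG, hG', hG'.isAssociatedHopfAlgebra_Exc⟩, fun h => ?_, fun H hH => ?_⟩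
    · exact not_matCongruent_genericForm_singularForm 1 ((h.hasForm hF').matCongruent hG')
    · rcases FiberFunctor.hasForm_genericForm_or_singularForm hH with ⟨q, hq, h⟩ | ⟨-, h⟩
      · obtain rfl : q = 1 := by
          rcases eq_or_eq_inv_of_add_inv_eq (hq.trans h1.symm) with h | h
          · exact h.symm
          · exact inv_eq_one.1 h.symm
        exact Or.inl (FiberFunctor.equivalent_of_hasForm h hF')
      · exact Or.inr (FiberFunctor.equivalent_of_hasForm h hG')
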